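/- **Model.** A network is a strongly connected directed graph with $n\ge 1$ nodes (the parties) and $m$ edges (unidirectional links); multiple edges and self-loops are allowed. A port numbering numbers, independently at every node, the outgoing edges by out-ports and the incoming edges by in-ports. The network is synchronous and anonymous: all parties run the same algorithm, and a party's behaviour depends only on a globally known number $N\ge n$, on its numbers of in-ports and out-ports, and on its input bit $x_i\in\{0,1\}$. In every round each party applies a trace-preserving completely positive map (a quantum operation, possibly with measurements) to its local quantum memory and the messages just received; the map produces its new memory and one message (a register of qubits, possibly empty) for each out-port. After a number of rounds that depends only on $N$ each party measures its memory and outputs a Boolean value. The bit complexity is the number of bits or qubits sent over all links in all rounds, in the worst case over the runs that occur with nonzero probability. **Theorem.** There is a single quantum algorithm for this model such that, for every $N$, every $n$ with $1\le n\le N$, every strongly connected digraph with $n$ nodes (unknown to the parties, multiple edges and self-loops allowed), every port numbering and every input $\mathbf{x}\in\{0,1\}^n$, with probability $1$ all parties output $H_1(\mathbf{x})$, the truth value of "exactly one of $x_1,\dots,x_n$ equals $1$"; that is, it solves solitude verification $\mathsf{SV}_n$ exactly. It runs in $O(N)$ rounds, and its bit complexity is $\tilde{O}(N^8)$, i.e.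 at most $C\,N^8\,(\log(N+1))^k$, whenever the graph has at most $N^2$ edges (in particular on all digraphs without parallel edges). The constants $C,k$ and the constant in $O(N)$ are absolute. -/

import Mathlib

open scoped BigOperators ComplexConjugate ENNReal

noncomputable section

/-- A directed graph with node set `Fin n` and edge set `Fin m`; multiple edges and self-loops are
allowed. -/
structure MultiDigraph (n m : ℕ) where
  src : Fin m → Fin n
  dst : Fin m → Fin n

namespace MultiDigraph

variable {n m : ℕ}

/-- Every node can be reached from every node along a directed path. -/
def StronglyConnected (G : MultiDigraph n m) : Prop :=
  ∀ u v : Fin n, Relation.ReflTransGen (fun a b => ∃ e, G.src e = a ∧ G.dst e = b) u v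

def outDeg (G : MultiDigraph n m) (v : Fin n) : ℕ := Fintype.card {e : Fin m // G.src e = v}

def inDeg (G : MultiDigraph n m) (v : Fin n) : ℕ := Fintype.card {e : Fin m // G.dst e = v}

end MultiDigraph

/-- A port numbering: at every node, independently of the other nodes, the outgoing edges are
numbered by the out-ports and the incoming edges by the in-ports. -/
structure PortNumbering {n m : ℕ} (G : MultiDigraph n m) where
  outPort : (v : Fin n) → {e : Fin m // G.src e = v} ≃ Fin (G.outDeg v)
  inPort : (v : Fin n) → {e : Fin m // G.dst e = v} ≃ Fin (G.inDeg v)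

/-- The scalar product of two finitely supported state vectors, written in an orthonormal basis
that is indexed by `β`. -/
def overlap {β : Type} (f g : β →₀ ℂ) : ℂ := f.sum fun c a => conj a * g c

/-- The tensor product of finitely many state vectors: its amplitudes are the products of the
amplitudes of the factors. -/
def tensorState {ι : Type} [Fintype ι] [DecidableEq ι] {β : ι → Type} (f : (i : ι) → (β i →₀ ℂ)) :
    ((i : ι) → β i) →₀ ℂ :=
  Finsupp.onFinset (Fintype.piFinset fun i => (f i).support) (fun c => ∏ i, f i (c i)) (by
    intro c hc
    rw [Fintype.mem_piFinset]
    intro i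
    rw [Finsupp.mem_support_iff]
    exact fun h => hc (Finset.prod_eq_zero (Finset.mem_univ i) h))

open scoped Classical in
/-- A quantum algorithm for synchronous anonymous networks in which the only global information is
a number `N` (an upper bound on the number of parties).

All parties run the same algorithm; the behaviour of a party depends only on `N`, on its numbers
`din` and `dout` of in-ports and out-ports, and on its input bit. A party stores a quantum system
with orthonormal basis `Mem`; a message is a register of qubits, with basis states given by bit
strings. In every round a party applies to its memory and to the messages on its in-ports one and
the same trace-preserving completely positive map, which produces a new memory and one message
for every out-port (the empty string costs nothing: no message).

The map is given by its Kraus operators, one for each `k : Outcome` (measurement outcomes included):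
`kraus N din dout k b` is the image of the basis state `b` under the `k`-th operator `K k`, and
`tracePreserving` says that the sum of `(K k)† * K k` over `k` is the identity, entry by entry.
After `rounds N` rounds every party measures its memory in the basis `Mem` and answers `output`. -/
structure QuantumAlgorithm where
  Mem : Type
  Outcome : Type
  rounds : (N : ℕ) → ℕ
  start : (N din dout : ℕ) → (input : Bool) → Mem
  kraus : (N din dout : ℕ) → (k : Outcome) → Mem × (Fin din → List Bool) →
    (Mem × (Fin dout → List Bool) →₀ ℂ)
  tracePreserving : ∀ (N din dout : ℕ) (b b' : Mem × (Fin din → List Bool)),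
    HasSum (fun k : Outcome => overlap (kraus N din dout k b) (kraus N din dout k b'))
      (if b = b' then 1 else 0)
  output : Mem → Bool

namespace QuantumAlgorithm

variable (A : QuantumAlgorithm) {n m : ℕ} {G : MultiDigraph n m} (P : PortNumbering G)

/-- The basis states of a whole network: the memories of all parties and the bit strings on all
links. -/
abbrev Config (n m : ℕ) : Type := (Fin n → A.Mem) × (Fin m → List Bool)

/-- The part of a basis state to which party `v` has access at the beginning of a round: its memory
and the messages on its in-ports. -/
def received (c : A.Config n m) (v : Fin n) : A.Mem × (Fin (G.inDeg v) → List Bool) :=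
  (c.1 v, fun i => c.2 ((P.inPort v).symm i).1)

/-- Sending: the message that the source of `e` has put on the out-port of `e` travels on `e`. -/
def send (s : (v : Fin n) → A.Mem × (Fin (G.outDeg v) → List Bool)) : A.Config n m :=
  (fun v => (s v).1, fun e => (s (G.src e)).2 (P.outPort (G.src e) ⟨e, rfl⟩))

/-- One round in which party `v` obtains the outcome `k v`: the tensor product of the Kraus
operators of the parties, followed by sending. The resulting vector is not normalized; its squared
norm is the probability of `k`. -/
def round (N : ℕ) (k : Fin n → A.Outcome) (ψ : A.Config n m →₀ ℂ) : A.Config n m →₀ ℂ :=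
  ψ.sum fun c a => a • Finsupp.mapDomain (A.send P)
    (tensorState fun v => A.kraus N (G.inDeg v) (G.outDeg v) (k v) (A.received P c v))

/-- The (unnormalized) state of the network on input `x` after `t` rounds with outcomes `o`. Its
squared norm is the probability of `o`. -/
def state (N : ℕ) (x : Fin n → Bool) : (t : ℕ) → (Fin t → Fin n → A.Outcome) → (A.Config n m →₀ ℂ)
  | 0, _ => Finsupp.single (fun v => A.start N (G.inDeg v) (G.outDeg v) (x v), fun _ => []) 1
  | t + 1, o => A.round P N (o (Fin.last t)) (state N x t (Fin.init o))

/-- The number of qubits (or bits) communicated during the first `t` rounds with outcomes `o`. In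
each round a link carries as many qubits as are needed for the longest bit string that occurs on
it with a nonzero amplitude. -/
def bitsSent (N : ℕ) (x : Fin n → Bool) : (t : ℕ) → (Fin t → Fin n → A.Outcome) → ℕ
  | 0, _ => 0
  | t + 1, o => bitsSent N x t (Fin.init o) +
      ∑ e : Fin m, (A.state P N x (t + 1) o).support.sup fun c => (c.2 e).length

/-- The probability that, on input `x`, all parties answer `b`. -/
def probAnswer (N : ℕ) (x : Fin n → Bool) (b : Bool) : ℝ≥0∞ :=
  ∑' o : Fin (A.rounds N) → Fin n → A.Outcome,
    ∑ c ∈ (A.state P N x (A.rounds N) o).support with ∀ v, A.output (c.1 v) = b,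
      ENNReal.ofReal (‖A.state P N x (A.rounds N) o c‖ ^ 2)

end QuantumAlgorithm

/-- The symmetric function `H_k`: is the Hamming weight of `x` equal to `k`? -/
def hammingIs {n : ℕ} (k : ℕ) (x : Fin n → Bool) : Bool :=
  decide ((Finset.univ.filter fun i => x i = true).card = k)

end

/-! Every active party draws a token, a subset of `Fin N`, in uniform superposition, and the tokens
flood the network. If no token or several different ones are present, every party sees this and
solitude is refuted. A single active party always yields exactly one token. The hard case is several
active parties that agree on a token.

In that case every party applies a Fourier transform to the token. If no memory betrays the token
`β`, the amplitude of the joint outcome `j` is proportional to `∑ β, ∏ v, phase (x v) β (j v)`,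
which factors as `∏ i, (1 + ∏ v, phaseFactor i (x v) (j v i))`. Let `k ≥ 2` parties be active and
suppose that all of them have the same stable view in the network labelled by inputs and outcomes.
In a strongly connected network all view classes are equally large (`classSize_eq`), here of size
`k`. At `i = k - 2` the class of active parties contributes a `k`-th power equal to `-1` and every
other class one equal to `1`, so the factor is `1 - 1 = 0` (`sum_prod_phase_eq_zero`). Hence every
outcome that occurs gives two active parties different views.

It remains to build views of depth `4 * N - 2` and to accept those that can arise with one active
party. Such a view contains the depth-`N` views of all nodes; acceptance would force all active
parties to share the view of the single active node of a witness network (`accepts_iff`).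

Unitarity demands records of the past, and interference demands that they be independent of a common
token; `floodLog` reconciles the two. The communication bound is a count: few messages can occur, so
they have codewords of length `O(N ^ 3)`. -/

noncomputable section

/-! ### Scalar products of finitely supported state vectors and their tensor products. -/

section StateVectors

variable {α β γ : Type}

theorem overlap_eq_sum {f : β →₀ ℂ} (g : β →₀ ℂ) {s : Finset β} (hs : f.support ⊆ s) :
    overlap f g = ∑ c ∈ s, conj (f c) * g c := by
  unfold overlap
  exact Finsupp.sum_of_support_subset f hs _ (by simp)

theorem overlap_finsuppSum_left (φ : α →₀ ℂ) (T : α → β →₀ ℂ) (g : β →₀ ℂ) :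
    overlap (φ.sum fun c a => a • T c) g = φ.sum fun c a => conj a * overlap (T c) g := by
  classical
  set s := φ.support.biUnion fun c => (T c).support with hs
  have hsub : (φ.sum fun c a => a • T c).support ⊆ s := by
    intro d hd
    obtain ⟨c, hc, h⟩ := Finset.mem_biUnion.1 (Finsupp.support_finsetSum hd)
    exact Finset.mem_biUnion.2 ⟨c, hc, Finsupp.support_smul h⟩
  rw [overlap_eq_sum g hsub]
  simp only [Finsupp.sum, Finsupp.coe_finsetSum, Finset.sum_apply, Finsupp.smul_apply, smul_eq_mul,
    map_sum, map_mul, Finset.sum_mul]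
  rw [Finset.sum_comm]
  refine Finset.sum_congr rfl fun c hc => ?_
  rw [overlap_eq_sum g (Finset.subset_biUnion_of_mem (fun c => (T c).support) hc), Finset.mul_sum]
  exact Finset.sum_congr rfl fun d _ => by ring

theorem overlap_finsuppSum_right (f : β →₀ ℂ) (φ : α →₀ ℂ) (T : α → β →₀ ℂ) :
    overlap f (φ.sum fun c a => a • T c) = φ.sum fun c a => a * overlap f (T c) := by
  simp only [overlap, Finsupp.sum, Finsupp.coe_finsetSum, Finset.sum_apply, Finsupp.smul_apply,
    smul_eq_mul, Finset.mul_sum]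
  rw [Finset.sum_comm]
  exact Finset.sum_congr rfl fun c _ => Finset.sum_congr rfl fun d _ => by ring

/-- A linear extension of an orthonormal family preserves scalar products. -/
theorem overlap_finsuppSum_of_orthonormal [DecidableEq α] {T : α → β →₀ ℂ}
    (hT : ∀ c c', overlap (T c) (T c') = if c = c' then 1 else 0) (φ ψ : α →₀ ℂ) :
    overlap (φ.sum fun c a => a • T c) (ψ.sum fun c a => a • T c) = overlap φ ψ := by
  rw [overlap_finsuppSum_left]
  unfold overlap
  refine Finset.sum_congr rfl fun c _ => ?_
  have h := overlap_finsuppSum_right (T c) ψ T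
  unfold overlap at h hT
  dsimp only at h ⊢
  rw [h]
  congr 1
  simp only [hT]
  simp [Finsupp.sum]
  intro h
  exact h.symm

theorem overlap_mapDomain {f : β → γ} (hf : Function.Injective f) (φ ψ : β →₀ ℂ) :
    overlap (Finsupp.mapDomain f φ) (Finsupp.mapDomain f ψ) = overlap φ ψ := by
  unfold overlap
  rw [Finsupp.sum_mapDomain_index_inj hf]
  simp only [Finsupp.mapDomain_apply hf]

theorem overlap_eq_zero_of_disjoint {f g : β →₀ ℂ} (h : ∀ c, f c ≠ 0 → g c = 0) :
    overlap f g = 0 :=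
  Finset.sum_eq_zero fun c hc => by simp [h c (Finsupp.mem_support_iff.1 hc)]

theorem overlap_single_one (a b : β) [Decidable (a = b)] :
    overlap (Finsupp.single a 1) (Finsupp.single b 1) = if a = b then 1 else 0 := by
  classical
  simp [overlap, Finsupp.single_apply, eq_comm]

theorem overlap_sum_single_of_injective {ι : Type} {g : ι → β} (hg : Function.Injective g)
    (s : Finset ι) (a b : ι → ℂ) :
    overlap (∑ i ∈ s, a i • Finsupp.single (g i) 1) (∑ i ∈ s, b i • Finsupp.single (g i) 1) =
      ∑ i ∈ s, conj (a i) * b i := by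
  classical
  have key : ∀ (a : ι → ℂ) (i : ι), (∑ i ∈ s, a i • Finsupp.single (g i) (1 : ℂ)) (g i) =
      if i ∈ s then a i else 0 := by
    intro a i
    simp [Finsupp.finsetSum_apply, Finsupp.single_apply, hg.eq_iff]
  have hsub : (∑ i ∈ s, a i • Finsupp.single (g i) (1 : ℂ)).support ⊆ s.image g := by
    intro d hd
    obtain ⟨c, hc, h⟩ := Finset.mem_biUnion.1 (Finsupp.support_finsetSum hd)
    have := Finsupp.support_smul h
    rw [Finsupp.mem_support_iff, Finsupp.single_apply] at this
    exact Finset.mem_image.2 ⟨c, hc, by by_contra hne; simp [hne] at this⟩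
  rw [overlap_eq_sum _ hsub, Finset.sum_image fun _ _ _ _ h => hg h]
  exact Finset.sum_congr rfl fun i hi => by rw [key, key, if_pos hi, if_pos hi]

theorem sum_norm_sq_eq_overlap (f : β →₀ ℂ) :
    ((∑ c ∈ f.support, ‖f c‖ ^ 2 : ℝ) : ℂ) = overlap f f := by
  unfold overlap Finsupp.sum
  push_cast
  refine Finset.sum_congr rfl fun c _ => ?_
  rw [Complex.conj_mul']

section Tensor

variable {ι : Type} [Fintype ι] [DecidableEq ι] {κ : ι → Type}

theorem tensorState_apply (f : (i : ι) → (κ i →₀ ℂ)) (c : (i : ι) → κ i) :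
    tensorState f c = ∏ i, f i (c i) := rfl

theorem overlap_tensorState (f g : (i : ι) → (κ i →₀ ℂ)) :
    overlap (tensorState f) (tensorState g) = ∏ i, overlap (f i) (g i) := by
  have hsub : (tensorState f).support ⊆ Fintype.piFinset fun i => (f i).support :=
    Finsupp.support_onFinset_subset
  rw [overlap_eq_sum _ hsub]
  simp only [overlap, Finsupp.sum]
  rw [Finset.prod_univ_sum]
  refine Finset.sum_congr rfl fun c _ => ?_
  rw [tensorState_apply, tensorState_apply, map_prod, Finset.prod_mul_distrib]

theorem tensorState_sum_single {τ : ι → Type} (S : (i : ι) → Finset (τ i))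
    (a : (i : ι) → τ i → ℂ) (g : (i : ι) → τ i → κ i) :
    tensorState (fun i => ∑ c ∈ S i, a i c • Finsupp.single (g i c) 1) =
      ∑ z ∈ Fintype.piFinset S, (∏ i, a i (z i)) •
        Finsupp.single (fun i => g i (z i)) (1 : ℂ) := by
  classical
  ext d
  simp only [tensorState_apply, Finsupp.finsetSum_apply, Finsupp.smul_apply, smul_eq_mul]
  rw [Finset.prod_univ_sum]
  refine Finset.sum_congr rfl fun z _ => ?_
  rw [Finset.prod_mul_distrib]
  congr 1
  simp only [Finsupp.single_apply, funext_iff]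
  rw [Finset.prod_ite_zero]
  simp

end Tensor

end StateVectors

/-! ### The evolution of a network as an isometry. -/

namespace QuantumAlgorithm

variable (A : QuantumAlgorithm) {n m : ℕ} {G : MultiDigraph n m} (P : PortNumbering G)

theorem send_injective : Function.Injective (A.send P) := by
  intro s s' h
  funext v
  have h1 : (s v).1 = (s' v).1 := congrFun (congrArg Prod.fst h) v
  refine Prod.ext h1 (funext fun p => ?_)
  have h2 := congrFun (congrArg Prod.snd h) ((P.outPort v).symm p).1
  obtain ⟨e, rfl⟩ : ∃ e, P.outPort v e = p := ⟨_, (P.outPort v).apply_symm_apply p⟩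
  obtain ⟨e, rfl⟩ := e
  simpa [send] using h2

theorem received_injective : Function.Injective (A.received P) := by
  intro c c' h
  refine Prod.ext (funext fun v => congrArg Prod.fst (congrFun h v)) (funext fun e => ?_)
  have h2 := congrFun (congrArg Prod.snd (congrFun h (G.dst e))) (P.inPort (G.dst e) ⟨e, rfl⟩)
  simpa [received] using h2

open scoped Classical in
-- Different basis states differ in the inbox of some party, and the local factor there vanishes;
-- the routing of messages only relabels basis states injectively.
theorem overlap_round {N : ℕ} {k : Fin n → A.Outcome}
    (hA : ∀ v b b', overlap (A.kraus N (G.inDeg v) (G.outDeg v) (k v) b)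
      (A.kraus N (G.inDeg v) (G.outDeg v) (k v) b') = if b = b' then 1 else 0)
    (φ ψ : A.Config n m →₀ ℂ) :
    overlap (A.round P N k φ) (A.round P N k ψ) = overlap φ ψ := by
  refine overlap_finsuppSum_of_orthonormal (fun c c' => ?_) φ ψ
  rw [overlap_mapDomain (A.send_injective P), overlap_tensorState]
  simp only [hA]
  rw [Finset.prod_ite_zero]
  simp only [Finset.mem_univ, true_implies, Finset.prod_const_one]
  refine if_congr ?_ rfl rfl
  rw [← funext_iff]
  exact (A.received_injective P).eq_iff

theorem round_sum {ι : Type} (N : ℕ) (k : Fin n → A.Outcome) (s : Finset ι)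
    (w : ι → ℂ) (ψ : ι → A.Config n m →₀ ℂ) :
    A.round P N k (∑ z ∈ s, w z • ψ z) = ∑ z ∈ s, w z • A.round P N k (ψ z) := by
  have h : A.round P N k = Finsupp.linearCombination ℂ fun c =>
      Finsupp.mapDomain (A.send P) (tensorState fun v =>
        A.kraus N (G.inDeg v) (G.outDeg v) (k v) (A.received P c v)) := rfl
  rw [h, map_sum]
  simp only [map_smul]

theorem round_single {N : ℕ} {k : Fin n → A.Outcome} {c : A.Config n m} {τ : Fin n → Type}
    {S : (v : Fin n) → Finset (τ v)} {a : (v : Fin n) → τ v → ℂ}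
    {g : (v : Fin n) → τ v → A.Mem × (Fin (G.outDeg v) → List Bool)}
    (h : ∀ v, A.kraus N (G.inDeg v) (G.outDeg v) (k v) (A.received P c v) =
      ∑ i ∈ S v, a v i • Finsupp.single (g v i) 1) :
    A.round P N k (Finsupp.single c 1) = ∑ z ∈ Fintype.piFinset S, (∏ v, a v (z v)) •
        Finsupp.single (A.send P fun v => g v (z v)) (1 : ℂ) := by
  unfold round
  rw [Finsupp.sum_single_index (by simp), one_smul]
  simp only [h]
  rw [tensorState_sum_single, Finsupp.mapDomain_finsetSum]
  simp only [Finsupp.mapDomain_smul, Finsupp.mapDomain_single]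

theorem exists_mem_support_of_mem_support_round {N : ℕ} {k : Fin n → A.Outcome}
    {ψ : A.Config n m →₀ ℂ} {d : A.Config n m} (hd : d ∈ (A.round P N k ψ).support) :
    ∃ c ∈ ψ.support, d ∈ (A.round P N k (Finsupp.single c 1)).support := by
  classical
  obtain ⟨c, hc, h⟩ := Finset.mem_biUnion.1 (Finsupp.support_finsetSum hd)
  refine ⟨c, hc, ?_⟩
  unfold round
  rw [Finsupp.sum_single_index (by simp), one_smul]
  exact Finsupp.support_smul h

open scoped Classical in
theorem overlap_state {N : ℕ}
    (hA : ∀ din dout k b b', overlap (A.kraus N din dout k b) (A.kraus N din dout k b') =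
      if b = b' then 1 else 0) (x : Fin n → Bool) :
    ∀ (t : ℕ) (o : Fin t → Fin n → A.Outcome),
      overlap (A.state P N x t o) (A.state P N x t o) = 1
  | 0, _ => by simp [state, overlap_single_one]
  | t + 1, o => by
    rw [state, overlap_round A P fun v b b' => hA _ _ _ b b']
    exact overlap_state hA x t (Fin.init o)

open scoped Classical in
/-- An algorithm without intermediate measurements answers `b` with certainty if every basis state
that can be observed at the end gives the answer `b`. -/
theorem probAnswer_eq_one [Unique A.Outcome] {N : ℕ}
    (hA : ∀ din dout k b b', overlap (A.kraus N din dout k b) (A.kraus N din dout k b') =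
      if b = b' then 1 else 0) {x : Fin n → Bool} {b : Bool}
    (hb : ∀ o, ∀ c ∈ (A.state P N x (A.rounds N) o).support, ∀ v, A.output (c.1 v) = b) :
    A.probAnswer P N x b = 1 := by
  unfold probAnswer
  rw [tsum_fintype, Fintype.sum_unique]
  rw [Finset.filter_true_of_mem (hb _), ← ENNReal.ofReal_sum_of_nonneg fun _ _ => by positivity]
  have h := sum_norm_sq_eq_overlap (A.state P N x (A.rounds N) default)
  rw [A.overlap_state P hA] at h
  rw [Complex.ofReal_eq_one.1 h, ENNReal.ofReal_one]

end QuantumAlgorithm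

/-! ### Reachability within a bounded number of steps. -/

namespace MultiDigraph

variable {n m : ℕ} (G : MultiDigraph n m)

open scoped Classical in
/-- The nodes that can be reached from `u` along at most `t` edges. -/
def ball (u : Fin n) : ℕ → Finset (Fin n)
  | 0 => {u}
  | t + 1 => ball u t ∪ Finset.univ.filter fun v => ∃ e, G.dst e = v ∧ G.src e ∈ ball u t

theorem mem_ball_succ {u v : Fin n} {t : ℕ} :
    v ∈ G.ball u (t + 1) ↔ v ∈ G.ball u t ∨ ∃ e, G.dst e = v ∧ G.src e ∈ G.ball u t := by
  simp [ball]

theorem ball_mono (u : Fin n) : Monotone (G.ball u) :=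
  monotone_nat_of_le_succ fun _ _ hv => (G.mem_ball_succ).2 (Or.inl hv)

theorem mem_ball_self (u : Fin n) (t : ℕ) : u ∈ G.ball u t :=
  G.ball_mono u (Nat.zero_le t) (by simp [ball])

theorem ball_eq_univ_of_closed (hG : G.StronglyConnected) {u : Fin n} {t : ℕ}
    (h : G.ball u (t + 1) = G.ball u t) : G.ball u t = Finset.univ := by
  refine Finset.eq_univ_of_forall fun v => ?_
  induction hG u v with
  | refl => exact G.mem_ball_self u t
  | tail _ hstep ih =>
    obtain ⟨e, rfl, rfl⟩ := hstep
    rw [← h, mem_ball_succ]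
    exact Or.inr ⟨e, rfl, ih⟩

/-- A ball that stops growing is closed under outgoing edges, hence is everything; until then each
step gains a node. -/
theorem ball_eq_univ_or_lt_card (hG : G.StronglyConnected) (u : Fin n) (t : ℕ) :
    G.ball u t = Finset.univ ∨ t < (G.ball u t).card := by
  induction t with
  | zero => exact Or.inr (by simp [ball])
  | succ t ih =>
    have hsub : G.ball u t ⊆ G.ball u (t + 1) := G.ball_mono u (Nat.le_succ t)
    rcases ih with ih | ih
    · exact Or.inl (Finset.univ_subset_iff.1 (ih ▸ hsub))
    · by_cases h : G.ball u (t + 1) = G.ball u t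
      · exact Or.inl (h.trans (G.ball_eq_univ_of_closed hG h))
      · have := Finset.card_lt_card (hsub.ssubset_of_ne (Ne.symm h))
        exact Or.inr (by omega)

theorem ball_eq_univ (hG : G.StronglyConnected) (u : Fin n) {t : ℕ} (ht : n ≤ t) :
    G.ball u t = Finset.univ := by
  refine (G.ball_eq_univ_or_lt_card hG u t).resolve_right fun h => ?_
  have := Finset.card_le_univ (G.ball u t)
  rw [Fintype.card_fin] at this
  omega

end MultiDigraph

/-! ### Views, their stabilization and the sizes of view classes. -/

namespace PortNumbering

variable {n m : ℕ} {G : MultiDigraph n m} (P : PortNumbering G)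

/-- The `i`-th incoming edge of `v`. -/
def inEdge (v : Fin n) (i : Fin (G.inDeg v)) : Fin m := ((P.inPort v).symm i).1

theorem dst_inEdge (v : Fin n) (i : Fin (G.inDeg v)) : G.dst (P.inEdge v i) = v :=
  ((P.inPort v).symm i).2

theorem exists_inEdge_eq (e : Fin m) : ∃ i, P.inEdge (G.dst e) i = e :=
  ⟨P.inPort (G.dst e) ⟨e, rfl⟩, by simp [inEdge]⟩

/-- The number of the out-port at which `e` starts. -/
def port (e : Fin m) : ℕ := P.outPort (G.src e) ⟨e, rfl⟩

theorem outPort_eq_port {v : Fin n} {e : Fin m} (h : G.src e = v) :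
    (P.outPort v ⟨e, h⟩ : ℕ) = P.port e := by
  subst h
  rfl

theorem eq_of_src_eq_of_port_eq {e e' : Fin m} (hs : G.src e = G.src e')
    (hp : P.port e = P.port e') : e = e' := by
  have h : (P.outPort (G.src e') ⟨e, hs⟩ : ℕ) = P.outPort (G.src e') ⟨e', rfl⟩ := by
    rw [outPort_eq_port, hp, port]
  exact congrArg Subtype.val ((P.outPort _).injective (Fin.ext h))

/-- What `v` can know after `t` rounds of exchanging all knowledge, when the initial knowledge of
the nodes is given by their labels. -/
def view {Λ : Type} [Encodable Λ] (ℓ : Fin n → Λ) : ℕ → Fin n → Finset ℕ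
  | 0, v => {Encodable.encode (ℓ v)}
  | t + 1, v => {Encodable.encode (view ℓ t v,
      List.ofFn fun i => (P.port (P.inEdge v i), view ℓ t (G.src (P.inEdge v i))))}

variable {Λ : Type} [Encodable Λ] (ℓ : Fin n → Λ)

theorem view_succ (t : ℕ) (v : Fin n) :
    P.view ℓ (t + 1) v = {Encodable.encode (P.view ℓ t v,
      List.ofFn fun i => (P.port (P.inEdge v i), P.view ℓ t (G.src (P.inEdge v i))))} :=
  rfl

section TwoNetworks

variable {n' m' : ℕ} {G' : MultiDigraph n' m'} (P' : PortNumbering G') (ℓ' : Fin n' → Λ)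

/-- Two different networks are allowed, as needed for comparison with an accepting witness; for one
network this says that views refine each other. -/
theorem view_succ_eq {t : ℕ} {v : Fin n} {v' : Fin n'}
    (h : P.view ℓ (t + 1) v = P'.view ℓ' (t + 1) v') :
    P.view ℓ t v = P'.view ℓ' t v' ∧ ∀ e, G.dst e = v → ∃ e', G'.dst e' = v' ∧
      P.port e = P'.port e' ∧ P.view ℓ t (G.src e) = P'.view ℓ' t (G'.src e') := by
  have h := Encodable.encode_injective (Finset.singleton_injective h)
  rw [Prod.mk.injEq] at h
  refine ⟨h.1, ?_⟩
  rintro e rfl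
  obtain ⟨i, hi⟩ := P.exists_inEdge_eq e
  have hmem : (P.port e, P.view ℓ t (G.src e)) ∈ List.ofFn fun i =>
      (P'.port (P'.inEdge v' i), P'.view ℓ' t (G'.src (P'.inEdge v' i))) := by
    rw [← h.2, List.mem_ofFn]
    exact ⟨i, by rw [hi]⟩
  obtain ⟨i', hi'⟩ := (List.mem_ofFn' _ _).1 hmem
  rw [Prod.mk.injEq] at hi'
  exact ⟨_, P'.dst_inEdge v' i', hi'.1.symm, hi'.2.symm⟩

theorem view_eq_of_le {s t : ℕ} (hst : s ≤ t) {v : Fin n} {v' : Fin n'}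
    (h : P.view ℓ t v = P'.view ℓ' t v') : P.view ℓ s v = P'.view ℓ' s v' := by
  induction hst with
  | refl => exact h
  | step _ ih => exact ih (P.view_succ_eq ℓ P' ℓ' h).1

theorem label_eq_of_view_eq {t : ℕ} {v : Fin n} {v' : Fin n'}
    (h : P.view ℓ t v = P'.view ℓ' t v') : ℓ v = ℓ' v' :=
  Encodable.encode_injective (Finset.singleton_injective
    (P.view_eq_of_le ℓ P' ℓ' (Nat.zero_le t) h))

/-- A view of depth `s + t` unfolds to the depth-`s` views of all nodes from which `v` is reached in
`t` steps, so a network showing the same view must realize them too. -/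
theorem exists_view_eq_of_mem_ball {s t : ℕ} {u v : Fin n} {v' : Fin n'} (hu : v ∈ G.ball u t)
    (h : P.view ℓ (s + t) v = P'.view ℓ' (s + t) v') :
    ∃ u', P.view ℓ s u = P'.view ℓ' s u' := by
  induction t generalizing v v' with
  | zero =>
    obtain rfl : v = u := by simpa [MultiDigraph.ball] using hu
    exact ⟨v', h⟩
  | succ t ih =>
    have h := P.view_succ_eq ℓ P' ℓ' h
    rcases G.mem_ball_succ.1 hu with hu | ⟨e, he, hu⟩
    · exact ih hu h.1
    · obtain ⟨e', -, -, he'⟩ := h.2 e he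
      exact ih hu he'

end TwoNetworks

/-- Nodes with the same view after `t` rounds have the same view after one more round. -/
def ViewStable (t : ℕ) : Prop :=
  ∀ u v, P.view ℓ t u = P.view ℓ t v → P.view ℓ (t + 1) u = P.view ℓ (t + 1) v

theorem ViewStable.succ {t : ℕ} (h : P.ViewStable ℓ t) : P.ViewStable ℓ (t + 1) := by
  intro u v huv
  have key : ∀ {u v}, P.view ℓ (t + 1) u = P.view ℓ (t + 1) v →
      (List.ofFn fun i => (P.port (P.inEdge u i), P.view ℓ t (G.src (P.inEdge u i)))) =
      List.ofFn fun i => (P.port (P.inEdge v i), P.view ℓ t (G.src (P.inEdge v i))) :=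
    fun huv => congrArg Prod.snd (Encodable.encode_injective (Finset.singleton_injective huv))
  have hl := key huv
  rw [P.view_succ ℓ (t + 1) u, P.view_succ ℓ (t + 1) v, huv, Finset.singleton_inj,
    Encodable.encode_inj, Prod.mk.injEq]
  refine ⟨rfl, ?_⟩
  -- The in-degrees of `u` and `v` are only propositionally equal, so the lists are compared as
  -- pairs of a length and an entry function.
  rw [List.ofFn_inj'] at hl ⊢
  have hd : G.inDeg u = G.inDeg v := congrArg Sigma.fst hl
  refine Sigma.ext hd ?_
  have hl2 := (Sigma.ext_iff.1 hl).2
  dsimp only at hl2 ⊢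
  refine Function.hfunext (by rw [hd]) fun i j hij => heq_of_eq ?_
  have hij' := congr_heq hl2 hij
  rw [Prod.mk.injEq] at hij' ⊢
  exact ⟨hij'.1, h _ _ hij'.2⟩

theorem viewStable_or_lt_card (t : ℕ) (hn : 0 < n) :
    P.ViewStable ℓ t ∨ t < (Finset.univ.image (P.view ℓ t)).card := by
  have : Nonempty (Fin n) := ⟨⟨0, hn⟩⟩
  induction t with
  | zero =>
    exact Or.inr (Finset.card_pos.2 (Finset.univ_nonempty.image _))
  | succ t ih =>
    by_cases hs : P.ViewStable ℓ t
    · exact Or.inl hs.succ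
    refine Or.inr (lt_of_le_of_lt (Nat.succ_le_of_lt (ih.resolve_left hs)) ?_)
    classical
    choose! f hf using fun (c : Finset ℕ) (hc : c ∈ Finset.univ.image (P.view ℓ (t + 1))) =>
      Finset.mem_image.1 hc
    have himg : Finset.univ.image (P.view ℓ t) =
        (Finset.univ.image (P.view ℓ (t + 1))).image fun c => P.view ℓ t (f c) := by
      rw [Finset.image_image]
      refine Finset.image_congr fun u _ => ?_
      have := (hf _ (Finset.mem_image_of_mem (P.view ℓ (t + 1)) (Finset.mem_univ u))).2
      exact (P.view_succ_eq ℓ P ℓ this).1.symm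
    -- Equally many views at depths `t` and `t + 1` would make the truncation map injective, which
    -- is stability.
    refine lt_of_le_of_ne (himg ▸ Finset.card_image_le) fun hcard => hs fun u v huv => ?_
    rw [himg] at hcard
    have hinj := Finset.card_image_iff.1 hcard
    have hu := Finset.mem_image_of_mem (P.view ℓ (t + 1)) (Finset.mem_univ u)
    have hv := Finset.mem_image_of_mem (P.view ℓ (t + 1)) (Finset.mem_univ v)
    refine hinj hu hv ?_
    dsimp only
    rw [(P.view_succ_eq ℓ P ℓ (hf _ hu).2).1, (P.view_succ_eq ℓ P ℓ (hf _ hv).2).1, huv]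

theorem viewStable {t : ℕ} (hn : 0 < n) (ht : n ≤ t) : P.ViewStable ℓ t := by
  refine (P.viewStable_or_lt_card ℓ t hn).resolve_right fun h => ?_
  have := (Finset.card_image_le (s := Finset.univ) (f := P.view ℓ t)).trans
    (Finset.card_le_univ _)
  rw [Fintype.card_fin] at this
  omega

/-- The number of nodes with the same view as `v`. -/
def classSize (t : ℕ) (v : Fin n) : ℕ :=
  (Finset.univ.filter fun w => P.view ℓ t w = P.view ℓ t v).card

/-- By stability, every node that looks like `G.dst e` has an incoming edge that leaves a node
looking like `G.src e` at the same out-port. An out-port carries only one edge, so different nodes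
have different sources. -/
theorem classSize_dst_le {t : ℕ} (h : P.ViewStable ℓ t) (e : Fin m) :
    P.classSize ℓ t (G.dst e) ≤ P.classSize ℓ t (G.src e) := by
  classical
  have hex : ∀ w, P.view ℓ t w = P.view ℓ t (G.dst e) → ∃ e', G.dst e' = w ∧
      P.port e = P.port e' ∧ P.view ℓ t (G.src e) = P.view ℓ t (G.src e') := fun w hw =>
    (P.view_succ_eq ℓ P ℓ (h _ _ hw.symm)).2 e rfl
  have : Nonempty (Fin m) := ⟨e⟩
  choose! f hf using hex
  refine Finset.card_le_card_of_injOn (fun w => G.src (f w)) (fun w hw => ?_) ?_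
  · simp only [Finset.coe_filter, Finset.mem_univ, true_and, Set.mem_ofPred_eq] at hw ⊢
    exact (hf w hw).2.2.symm
  · intro w hw w' hw' hww
    simp only [Finset.coe_filter, Finset.mem_univ, true_and, Set.mem_ofPred_eq] at hw hw'
    have := P.eq_of_src_eq_of_port_eq hww ((hf w hw).2.1.symm.trans (hf w' hw').2.1)
    rw [← (hf w hw).1, ← (hf w' hw').1, this]

/-- In a strongly connected network all classes of nodes with the same view are equally large. -/
theorem classSize_eq (hG : G.StronglyConnected) {t : ℕ} (h : P.ViewStable ℓ t) (u v : Fin n) :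
    P.classSize ℓ t u = P.classSize ℓ t v := by
  have key : ∀ u v, P.classSize ℓ t v ≤ P.classSize ℓ t u := by
    intro u v
    induction hG u v with
    | refl => exact le_rfl
    | tail _ hstep ih =>
      obtain ⟨e, rfl, rfl⟩ := hstep
      exact (P.classSize_dst_le ℓ h e).trans ih
  exact le_antisymm (key v u) (key u v)

end PortNumbering

/-! ### Fourier phases and destructive interference. -/

/-- The outcomes of a measurement in the Fourier basis: one residue modulo `k` for every size
`k = i + 2` that the set of active parties may have. -/
abbrev FourierIndex (N : ℕ) : Type := (i : Fin N) → Fin (i + 2)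

/-- The phase factors for active parties satisfy `phaseFactor k true j ^ (k + 2) = -1`, those for
passive parties `phaseFactor k false j ^ (k + 2) = 1`. -/
def phaseFactor (k : ℕ) (x : Bool) (j : ℕ) : ℂ :=
  Complex.exp (Real.pi * Complex.I * (x.toNat + 2 * j) / (k + 2))

def phase {N : ℕ} (x : Bool) (β : Finset (Fin N)) (j : FourierIndex N) : ℂ :=
  ∏ i ∈ β, phaseFactor i x (j i)

theorem phaseFactor_pow (k : ℕ) (x : Bool) (j : ℕ) :
    phaseFactor k x j ^ (k + 2) = if x then -1 else 1 := by
  have hk : (k : ℂ) + 2 ≠ 0 := by exact_mod_cast (by omega : k + 2 ≠ 0)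
  rw [phaseFactor, ← Complex.exp_nat_mul]
  have : ((k + 2 : ℕ) : ℂ) * (Real.pi * Complex.I * (x.toNat + 2 * j) / (k + 2)) =
      x.toNat * (Real.pi * Complex.I) + j * (2 * Real.pi * Complex.I) := by
    push_cast
    field_simp
  rw [this, Complex.exp_add, Complex.exp_nat_mul_two_pi_mul_I, mul_one]
  cases x <;> simp [Complex.exp_pi_mul_I]

theorem conj_phaseFactor_mul_self (k : ℕ) (x : Bool) (j : ℕ) :
    conj (phaseFactor k x j) * phaseFactor k x j = 1 := by
  have : ‖phaseFactor k x j‖ = 1 := by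
    have h : Real.pi * Complex.I * (x.toNat + 2 * j) / (k + 2) =
        ((Real.pi * (x.toNat + 2 * j) / (k + 2) : ℝ) : ℂ) * Complex.I := by
      push_cast
      ring
    rw [phaseFactor, h, Complex.norm_exp_ofReal_mul_I]
  rw [Complex.conj_mul', this]
  norm_num

theorem sum_phaseFactor (k : ℕ) (x : Bool) : ∑ j : Fin (k + 2), phaseFactor k x j = 0 := by
  rw [Fin.sum_univ_eq_sum_range fun j => phaseFactor k x j]
  have h : ∀ j : ℕ, phaseFactor k x j = Complex.exp (Real.pi * Complex.I * x.toNat / (k + 2)) *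
      Complex.exp (2 * Real.pi * Complex.I / (k + 2 : ℕ)) ^ j := by
    intro j
    rw [phaseFactor, ← Complex.exp_nat_mul, ← Complex.exp_add]
    congr 1
    push_cast
    ring
  simp only [h]
  rw [← Finset.mul_sum, (Complex.isPrimitiveRoot_exp (k + 2) (by omega)).geom_sum_eq_zero
    (by omega), mul_zero]

/-- The sum factors over coordinates; one that lies in exactly one of the two tokens contributes a
vanishing sum of rotated roots of unity. -/
theorem sum_conj_phase_mul_phase {N : ℕ} (x : Bool) (β β' : Finset (Fin N)) :
    ∑ j : FourierIndex N, conj (phase x β j) * phase x β' j =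
      if β = β' then (Fintype.card (FourierIndex N) : ℂ) else 0 := by
  have hterm : ∀ j : FourierIndex N, conj (phase x β j) * phase x β' j =
      ∏ i, ((if i ∈ β then conj (phaseFactor i x (j i)) else 1) *
        if i ∈ β' then phaseFactor i x (j i) else 1) := by
    intro j
    rw [phase, phase, map_prod, Finset.prod_mul_distrib, Fintype.prod_ite_mem,
      Fintype.prod_ite_mem]
  have hfactor : ∀ i : Fin N, (∑ j : Fin (i + 2),
      ((if i ∈ β then conj (phaseFactor i x j) else 1) * if i ∈ β' then phaseFactor i x j else 1)) =
      if i ∈ β ↔ i ∈ β' then ((i + 2 : ℕ) : ℂ) else 0 := by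
    intro i
    by_cases h : i ∈ β <;> by_cases h' : i ∈ β' <;>
      simp [h, h', conj_phaseFactor_mul_self, sum_phaseFactor, ← map_sum]
  have h := Finset.prod_univ_sum (fun i : Fin N => (Finset.univ : Finset (Fin (i + 2))))
    fun i j => (if i ∈ β then conj (phaseFactor i x j) else 1) *
      if i ∈ β' then phaseFactor i x j else 1
  rw [Fintype.piFinset_univ] at h
  simp only [hterm]
  rw [← h]
  simp only [hfactor]
  rw [Finset.prod_ite_zero, Fintype.card_pi]
  simp only [Finset.mem_univ, true_implies, Fintype.card_fin, Finset.ext_iff, Nat.cast_prod]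

/-- This is why tokens are subsets: coordinate `i` tests the guess that `i + 2` parties are active,
and one vanishing factor annihilates the amplitude. The number of active parties need not be known.
-/
theorem sum_prod_phase {N n : ℕ} (x : Fin n → Bool) (j : Fin n → FourierIndex N) :
    ∑ β : Finset (Fin N), ∏ v, phase (x v) β (j v) =
      ∏ i : Fin N, (1 + ∏ v, phaseFactor i (x v) (j v i)) := by
  rw [Finset.prod_one_add, Finset.powerset_univ]
  exact Finset.sum_congr rfl fun β _ => Finset.prod_comm

/-- Destructive interference: the outcomes for which all active parties have the same view have
amplitude zero. -/
theorem sum_prod_phase_eq_zero {N n m : ℕ} {G : MultiDigraph n m} (P : PortNumbering G)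
    (hG : G.StronglyConnected) (x : Fin n → Bool) (j : Fin n → FourierIndex N) {t : ℕ}
    (hs : P.ViewStable (fun v => (x v, some (j v))) t)
    (hk : 2 ≤ (Finset.univ.filter fun v => x v = true).card)
    (hkN : (Finset.univ.filter fun v => x v = true).card ≤ N)
    (hview : ∀ u v, x u = true → x v = true →
      P.view (fun v => (x v, some (j v))) t u = P.view (fun v => (x v, some (j v))) t v) :
    ∑ β : Finset (Fin N), ∏ v, phase (x v) β (j v) = 0 := by
  classical
  set ℓ : Fin n → Bool × Option (FourierIndex N) := fun v => (x v, some (j v)) with hℓ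
  obtain ⟨k, hk'⟩ := Nat.exists_eq_add_of_le' hk
  obtain ⟨a, ha⟩ := Finset.card_pos.1 (by omega : 0 < (Finset.univ.filter fun v => x v = true).card)
  rw [Finset.mem_filter] at ha
  have hlab : ∀ {u v}, P.view ℓ t u = P.view ℓ t v → x u = x v ∧ j u = j v := fun h => by
    simpa [hℓ] using P.label_eq_of_view_eq ℓ P ℓ h
  -- All classes are as large as that of `a`, which consists of exactly the active parties.
  have hsize : ∀ v, P.classSize ℓ t v = k + 2 := by
    intro v
    rw [P.classSize_eq ℓ hG hs v a, ← hk', PortNumbering.classSize]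
    congr 1
    ext w
    simp only [Finset.mem_filter, Finset.mem_univ, true_and]
    exact ⟨fun h => (hlab h).1.trans ha.2, fun h => hview _ _ h ha.2⟩
  rw [sum_prod_phase]
  refine Finset.prod_eq_zero (Finset.mem_univ (⟨k, by omega⟩ : Fin N)) ?_
  dsimp only
  have : Nonempty (Fin n) := ⟨a⟩
  choose! r hr using fun (c : Finset ℕ) (hc : c ∈ Finset.univ.image (P.view ℓ t)) =>
    Finset.mem_image.1 hc
  have hr' : ∀ v, P.view ℓ t (r (P.view ℓ t v)) = P.view ℓ t v := fun v =>
    (hr _ (Finset.mem_image_of_mem _ (Finset.mem_univ v))).2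
  -- Equal views carry equal labels, so the factor is constant on each class and the class
  -- contributes its `(k + 2)`-th power.
  have hprod : ∏ v, phaseFactor k (x v) (j v ⟨k, by omega⟩) =
      ∏ c ∈ Finset.univ.image (P.view ℓ t), if c = P.view ℓ t a then (-1 : ℂ) else 1 := by
    have h := Finset.prod_comp (s := Finset.univ)
      (fun c => phaseFactor k (x (r c)) (j (r c) ⟨k, by omega⟩)) (P.view ℓ t)
    rw [Finset.prod_congr rfl fun v _ => by rw [(hlab (hr' v)).1, (hlab (hr' v)).2]] at h
    rw [h]
    refine Finset.prod_congr rfl fun c hc => ?_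
    obtain ⟨v, -, rfl⟩ := Finset.mem_image.1 hc
    have hv := hsize v
    unfold PortNumbering.classSize at hv
    rw [hv, phaseFactor_pow, (hlab (hr' v)).1]
    refine if_congr ⟨fun h => hview _ _ h ha.2, fun h => (hlab h).1.trans ha.2⟩ rfl rfl
  rw [hprod, Finset.prod_ite_eq' , if_pos (Finset.mem_image_of_mem _ (Finset.mem_univ a))]
  norm_num

/-! ### Short codewords for the messages that can occur. -/

/-- A finite part of a countable alphabet can be given short codewords. -/
theorem exists_injective_code {α ι : Type} [Encodable α] [Fintype ι] (f : ι → α) {L : ℕ}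
    (hL : Fintype.card ι ≤ 2 ^ L) :
    ∃ c : α → List Bool, Function.Injective c ∧ ∀ i, (c (f i)).length ≤ L + 1 := by
  classical
  obtain ⟨g⟩ : Nonempty (ι ↪ (Fin L → Bool)) :=
    Function.Embedding.nonempty_of_card_le (by simpa using hL)
  -- The first bit separates short codewords from unary ones. The latter make the code total, as a
  -- party's operation must be defined on all basis states.
  refine ⟨fun a => if h : a ∈ Set.range f then
    false :: List.ofFn (g (Set.rangeSplitting f ⟨a, h⟩)) else
    true :: List.replicate (Encodable.encode a) true, ?_, ?_⟩
  · intro a b hab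
    dsimp only at hab
    split_ifs at hab with ha hb hb
    · simp only [List.cons.injEq, true_and] at hab
      have := Set.rangeSplitting_injective f (g.injective (List.ofFn_injective hab))
      exact congrArg Subtype.val this
    · simp at hab
    · simp at hab
    · simp only [List.cons.injEq, true_and] at hab
      have := congrArg List.length hab
      simp only [List.length_replicate] at this
      exact Encodable.encode_injective this
  · intro i
    dsimp only
    rw [dif_pos (Set.mem_range_self i)]
    simp

namespace PortNumbering

/-- Source, destination, out-port and in-port of every edge. -/
def edgeTable {n m : ℕ} (p : Σ G : MultiDigraph n m, PortNumbering G) :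
    Fin m → Fin n × Fin n × Fin m × Fin m := fun e =>
  (p.1.src e, p.1.dst e,
    Fin.castLE ((Fintype.card_subtype_le _).trans (Fintype.card_fin m).le)
      (p.2.outPort (p.1.src e) ⟨e, rfl⟩),
    Fin.castLE ((Fintype.card_subtype_le _).trans (Fintype.card_fin m).le)
      (p.2.inPort (p.1.dst e) ⟨e, rfl⟩))

theorem edgeTable_injective {n m : ℕ} : Function.Injective (edgeTable (n := n) (m := m)) := by
  rintro ⟨⟨s, d⟩, P⟩ ⟨⟨s', d'⟩, P'⟩ h
  obtain rfl : s = s' := funext fun e => congrArg (fun q => q.1) (congrFun h e)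
  obtain rfl : d = d' := funext fun e => congrArg (fun q => q.2.1) (congrFun h e)
  obtain ⟨o, i⟩ := P
  obtain ⟨o', i'⟩ := P'
  have ho : o = o' := by
    funext v
    ext ⟨e, rfl⟩
    exact congrArg (fun q => (q.2.2.1 : ℕ)) (congrFun h e)
  have hi : i = i' := by
    funext v
    ext ⟨e, rfl⟩
    exact congrArg (fun q => (q.2.2.2 : ℕ)) (congrFun h e)
  rw [ho, hi]

instance {n m : ℕ} : Fintype (Σ G : MultiDigraph n m, PortNumbering G) :=
  Fintype.ofInjective _ edgeTable_injective

theorem card_sigma_le (n m : ℕ) :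
    Fintype.card (Σ G : MultiDigraph n m, PortNumbering G) ≤ (n * (n * (m * m))) ^ m :=
  (Fintype.card_le_of_injective _ edgeTable_injective).trans (by simp)

end PortNumbering

/-- The register of a party that has seen only the given token. -/
def tokenSet {N : ℕ} : Option (Finset (Fin N)) → Finset ℕ
  | none => ∅
  | some β => {Encodable.encode β}

/-- What a party knows at the beginning of the second phase: its input and, if the first phase was
successful, the outcome in the Fourier basis. -/
abbrev Label (N : ℕ) : Type := Bool × Option (FourierIndex N)

/-- The situations in which messages are sent, on a network with at most `N` nodes and at most
`N ^ 2` edges: in the first phase the choice of the tokens that have been seen, in the second phase a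
labelled network with an edge and a time. -/
abbrev Situation (N : ℕ) : Type :=
  (Σ n : Fin (N + 1), Fin n → Option (Finset (Fin N))) ⊕
  (Σ n : Fin (N + 1), Σ m : Fin (N ^ 2 + 1), (Σ G : MultiDigraph n m, PortNumbering G) ×
    (Fin n → Label N) × Fin m × Fin (5 * N + 1))

/-- The content of the message: a port number (only in the second phase) and a register. -/
def Situation.content {N : ℕ} : Situation N → ℕ × Finset ℕ
  | .inl ⟨_, z⟩ => (0, Finset.univ.biUnion fun u => tokenSet (z u))
  | .inr ⟨_, _, ⟨G, P⟩, ℓ, e, t⟩ => (P.port e, P.view ℓ t (G.src e))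

/-- A bound on the lengths of messages. -/
def codeLength (N : ℕ) : ℕ := 7 * N ^ 3 + 12 * N + 1

theorem card_label_le (N : ℕ) : Fintype.card (Label N) ≤ 2 ^ (N ^ 2 + 2) := by
  have h : Fintype.card (FourierIndex N) ≤ 2 ^ N ^ 2 := by
    rw [Fintype.card_pi, pow_two, pow_mul]
    refine (Finset.prod_le_pow_card _ _ (2 ^ N) fun i _ => ?_).trans (by simp)
    rw [Fintype.card_fin]
    have := i.2
    have := N.lt_two_pow_self
    omega
  rw [Fintype.card_prod, Fintype.card_option, Fintype.card_bool, pow_add]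
  have := Nat.one_le_two_pow (n := N ^ 2)
  omega

/-- In the exponent, the edge table costs `6 * N` for each of at most `N ^ 2` edges, and the labels
`(N ^ 2 + 2) * N`. The chosen edge, the time and the two sizes cost `2 * N`, `5 * N`, `N` and `2 *
N`; the final `1` pays for having two phases. -/
theorem card_situation_le (N : ℕ) : Fintype.card (Situation N) ≤ 2 ^ codeLength N := by
  have hN : N + 1 ≤ 2 ^ N := N.lt_two_pow_self
  have hN2 : N ^ 2 + 1 ≤ 2 ^ (2 * N) := by
    rw [mul_comm, pow_mul]
    exact Nat.pow_lt_pow_left N.lt_two_pow_self (by omega)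
  have h1 : Fintype.card (Σ n : Fin (N + 1), Fin n → Option (Finset (Fin N))) ≤
      2 ^ (N + (N + 1) * N) := by
    rw [Fintype.card_sigma]
    refine (Finset.sum_le_card_nsmul _ _ (2 ^ ((N + 1) * N)) fun n _ => ?_).trans ?_
    · rw [Fintype.card_fun, Fintype.card_option, Fintype.card_finset, Fintype.card_fin,
        Fintype.card_fin, pow_mul]
      have := Nat.one_le_two_pow (n := N)
      exact (Nat.pow_le_pow_left (by rw [pow_succ]; omega) _).trans
        (Nat.pow_le_pow_right (by positivity) (by omega))
    · rw [Finset.card_univ, Fintype.card_fin, smul_eq_mul, pow_add]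
      exact Nat.mul_le_mul_right _ hN
  have h2 : Fintype.card (Σ n : Fin (N + 1), Σ m : Fin (N ^ 2 + 1),
      (Σ G : MultiDigraph n m, PortNumbering G) × (Fin n → Label N) × Fin m × Fin (5 * N + 1)) ≤
      2 ^ (7 * N ^ 3 + 12 * N) := by
    rw [Fintype.card_sigma]
    have key : ∀ (n : Fin (N + 1)) (m : Fin (N ^ 2 + 1)),
        Fintype.card ((Σ G : MultiDigraph n m, PortNumbering G) × (Fin n → Label N) × Fin m ×
          Fin (5 * N + 1)) ≤
        2 ^ (6 * N * N ^ 2) * (2 ^ ((N ^ 2 + 2) * N) * (2 ^ (2 * N) * 2 ^ (5 * N))) := by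
      intro n m
      have hn : (n : ℕ) ≤ 2 ^ N := by omega
      have hm : (m : ℕ) ≤ 2 ^ (2 * N) := by omega
      rw [Fintype.card_prod, Fintype.card_prod, Fintype.card_prod, Fintype.card_fun,
        Fintype.card_fin, Fintype.card_fin, Fintype.card_fin]
      refine Nat.mul_le_mul ?_ (Nat.mul_le_mul ?_ (Nat.mul_le_mul hm (5 * N).lt_two_pow_self))
      · refine (PortNumbering.card_sigma_le n m).trans ?_
        calc ((n : ℕ) * (n * (m * m))) ^ (m : ℕ)
            ≤ (2 ^ N * (2 ^ N * (2 ^ (2 * N) * 2 ^ (2 * N)))) ^ (m : ℕ) := by gcongr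
          _ = (2 ^ (6 * N)) ^ (m : ℕ) := by
            rw [← pow_add, ← pow_add, ← pow_add]
            congr 2
            ring
          _ ≤ (2 ^ (6 * N)) ^ (N ^ 2) := Nat.pow_le_pow_right (by positivity) (by omega)
          _ = 2 ^ (6 * N * N ^ 2) := (pow_mul 2 (6 * N) (N ^ 2)).symm
      · rw [pow_mul]
        exact (Nat.pow_le_pow_left (card_label_le N) _).trans
          (Nat.pow_le_pow_right (by positivity) (by omega))
    refine (Finset.sum_le_card_nsmul _ _ _ fun n _ => by
      rw [Fintype.card_sigma]
      exact Finset.sum_le_card_nsmul _ _ _ fun m _ => key n m).trans ?_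
    rw [Finset.card_univ, Finset.card_univ, Fintype.card_fin, Fintype.card_fin, smul_eq_mul,
      smul_eq_mul]
    refine (Nat.mul_le_mul hN (Nat.mul_le_mul_right _ hN2)).trans (le_of_eq ?_)
    simp only [← pow_add]
    congr 1
    ring
  rw [Fintype.card_sum, codeLength, pow_succ 2]
  have h3 : 2 ^ (N + (N + 1) * N) ≤ 2 ^ (7 * N ^ 3 + 12 * N) := by
    refine Nat.pow_le_pow_right (by positivity) ?_
    have : N ^ 2 ≤ N ^ 3 + N := by
      rcases Nat.eq_zero_or_pos N with rfl | h
      · simp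
      · exact (Nat.pow_le_pow_right h (by omega)).trans (Nat.le_add_right _ _)
    nlinarith
  omega

/-- The bit strings by which messages are represented. -/
def codeword (N : ℕ) : ℕ × Finset ℕ → List Bool :=
  (exists_injective_code (Situation.content (N := N)) (card_situation_le N)).choose

theorem codeword_injective (N : ℕ) : Function.Injective (codeword N) :=
  (exists_injective_code (Situation.content (N := N)) (card_situation_le N)).choose_spec.1

theorem length_codeword_le {N : ℕ} (s : Situation N) :
    (codeword N s.content).length ≤ codeLength N + 1 :=
  (exists_injective_code (Situation.content (N := N)) (card_situation_le N)).choose_spec.2 s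

def decodeword (N : ℕ) : List Bool → ℕ × Finset ℕ := Function.invFun (codeword N)

@[simp]
theorem decodeword_codeword (N : ℕ) (q : ℕ × Finset ℕ) : decodeword N (codeword N q) = q :=
  Function.leftInverse_invFun (codeword_injective N) q

/-! ### The local operation of a party and its reversibility. -/

/-- The memory of a party: the time, its input, a record of the past that makes the evolution
reversible, and a register that holds the information to be sent. -/
@[ext]
structure PartyMemory where
  time : ℕ
  input : Bool
  log : ℕ
  register : Finset ℕ

namespace PartyMemory

/-- The value `a` relative to `c`. -/
def mask {α : Type} [DecidableEq α] (c a : α) : Option α := if a = c then none else some a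

theorem mask_injective {α : Type} [DecidableEq α] (c : α) : Function.Injective (mask c) := by
  intro a b h
  unfold mask at h
  split_ifs at h with ha hb hb
  · rw [ha, hb]
  · exact Option.some_injective _ h

/-- A party collects all tokens that it has seen. -/
def merged (N : ℕ) {d : ℕ} (b : PartyMemory × (Fin d → List Bool)) : Finset ℕ :=
  b.1.register ∪ Finset.univ.biUnion fun i => (decodeword N (b.2 i)).2

def fullLog {d : ℕ} (b : PartyMemory × (Fin d → List Bool)) : ℕ :=
  Encodable.encode (b.1.log, b.1.register, List.ofFn b.2)

/-- The record of a round of flooding. It does not depend on the token if the party and its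
neighbours have seen at most one token. -/
def floodLog (N : ℕ) {d : ℕ} (b : PartyMemory × (Fin d → List Bool)) : ℕ :=
  Encodable.encode (b.1.log, mask (merged N b) b.1.register,
    List.ofFn fun i => mask (codeword N (0, merged N b)) (b.2 i))

def IsToken (N : ℕ) (c : Finset ℕ) : Prop := ∃ β : Finset (Fin N), c = tokenSet (some β)

open scoped Classical in
/-- The new record: the first round prepares the tokens, the next `N` rounds flood the network with
them, the following round forwards them once more and applies the Fourier transform, and the
remaining rounds build views. -/
def newLog (N : ℕ) {d : ℕ} (b : PartyMemory × (Fin d → List Bool)) : ℕ :=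
  if b.1.time = 0 then fullLog b
  else if b.1.time ≤ N then floodLog N b
  else if b.1.time = N + 1 then Encodable.encode
    (floodLog N b, if IsToken N (merged N b) then none else some (merged N b))
  else fullLog b

def tokenChoices (N : ℕ) (x : Bool) : Finset (Option (Finset (Fin N))) :=
  if x then Finset.univ.image some else {none}

def tokenAmplitude (N : ℕ) (x : Bool) : ℂ := ((√((tokenChoices N x).card) : ℝ) : ℂ)⁻¹

/-- Active parties choose a token in uniform superposition. -/
def initialRegister (N : ℕ) (x : Bool) : Finset ℕ →₀ ℂ :=
  ∑ o ∈ tokenChoices N x, tokenAmplitude N x • Finsupp.single (tokenSet o) 1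

def fourierAmplitude {N : ℕ} (x : Bool) (β : Finset (Fin N)) (j : FourierIndex N) : ℂ :=
  ((√(Fintype.card (FourierIndex N)) : ℝ) : ℂ)⁻¹ * phase x β j

open scoped Classical in
/-- The Fourier transform of the token, if exactly one has been seen. -/
def fourierRegister (N : ℕ) (x : Bool) (c : Finset ℕ) : Finset ℕ →₀ ℂ :=
  if h : IsToken N c then ∑ j : FourierIndex N,
    fourierAmplitude x h.choose j • Finsupp.single {Encodable.encode ((x, some j) : Label N)} 1
  else Finsupp.single {Encodable.encode ((x, none) : Label N)} 1

/-- After time `N + 1` basis states go to basis states and no interference is needed any more, so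
`newLog` may then record everything. -/
def newRegister (N : ℕ) {d : ℕ} (b : PartyMemory × (Fin d → List Bool)) : Finset ℕ →₀ ℂ :=
  if b.1.time = 0 then initialRegister N b.1.input
  else if b.1.time ≤ N then Finsupp.single (merged N b) 1
  else if b.1.time = N + 1 then fourierRegister N b.1.input (merged N b)
  else Finsupp.single
    {Encodable.encode (b.1.register, List.ofFn fun i => decodeword N (b.2 i))} 1

/-- While flooding, the port is replaced by `0`, so that `floodLog` can compare a message with the
codeword of the merged set. -/
def emit (N : ℕ) {d : ℕ} (d' : ℕ) (b : PartyMemory × (Fin d → List Bool)) (c : Finset ℕ) :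
    PartyMemory × (Fin d' → List Bool) :=
  (⟨b.1.time + 1, b.1.input, newLog N b, c⟩,
    fun p => codeword N (if b.1.time ≤ N then 0 else p, c))

/-- The operation that a party applies in every round. -/
def evolve (N din dout : ℕ) (b : PartyMemory × (Fin din → List Bool)) :
    PartyMemory × (Fin dout → List Bool) →₀ ℂ :=
  Finsupp.mapDomain (emit N dout b) (newRegister N b)

theorem tokenSet_injective {N : ℕ} : Function.Injective (tokenSet (N := N)) := by
  rintro (_ | β) (_ | β') h <;> simp [tokenSet] at h ⊢
  exact h

theorem tokenChoices_card_pos (N : ℕ) (x : Bool) : 0 < (tokenChoices N x).card := by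
  cases x <;> simp [tokenChoices, Finset.univ_nonempty]

theorem conj_inv_sqrt_mul_self (k : ℕ) :
    conj ((√k : ℝ) : ℂ)⁻¹ * ((√k : ℝ) : ℂ)⁻¹ = (k : ℂ)⁻¹ := by
  rw [map_inv₀, Complex.conj_ofReal, ← mul_inv, ← Complex.ofReal_mul,
    Real.mul_self_sqrt (Nat.cast_nonneg k), Complex.ofReal_natCast]

theorem overlap_initialRegister (N : ℕ) (x : Bool) :
    overlap (initialRegister N x) (initialRegister N x) = 1 := by
  unfold initialRegister
  rw [overlap_sum_single_of_injective tokenSet_injective, Finset.sum_const, tokenAmplitude,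
    conj_inv_sqrt_mul_self, nsmul_eq_mul, mul_inv_cancel₀]
  exact_mod_cast (tokenChoices_card_pos N x).ne'

theorem fourierRegister_tokenSet {N : ℕ} (x : Bool) (β : Finset (Fin N)) :
    fourierRegister N x (tokenSet (some β)) = ∑ j : FourierIndex N,
      fourierAmplitude x β j •
        Finsupp.single {Encodable.encode ((x, some j) : Label N)} 1 := by
  have h : IsToken N (tokenSet (some β)) := ⟨β, rfl⟩
  have hβ : h.choose = β := Option.some_injective _ (tokenSet_injective h.choose_spec.symm)
  rw [fourierRegister, dif_pos h, hβ]

theorem fourierRegister_of_not_isToken {N : ℕ} (x : Bool) {c : Finset ℕ} (hc : ¬ IsToken N c) :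
    fourierRegister N x c = Finsupp.single {Encodable.encode ((x, none) : Label N)} 1 := by
  rw [fourierRegister, dif_neg hc]

theorem overlap_fourierRegister {N : ℕ} (x : Bool) (β β' : Finset (Fin N)) :
    overlap (fourierRegister N x (tokenSet (some β))) (fourierRegister N x (tokenSet (some β'))) =
      if β = β' then 1 else 0 := by
  rw [fourierRegister_tokenSet, fourierRegister_tokenSet, overlap_sum_single_of_injective]
  · have : ∀ j : FourierIndex N, conj (fourierAmplitude x β j) * fourierAmplitude x β' j =
        (Fintype.card (FourierIndex N) : ℂ)⁻¹ * (conj (phase x β j) * phase x β' j) := by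
      intro j
      rw [← conj_inv_sqrt_mul_self, fourierAmplitude, fourierAmplitude, map_mul]
      ring
    simp only [this]
    rw [← Finset.mul_sum, sum_conj_phase_mul_phase, mul_ite, mul_zero, inv_mul_cancel₀]
    exact_mod_cast Fintype.card_ne_zero
  · intro j j' h
    simpa using h

theorem eq_of_fullLog_eq {d : ℕ} {b b' : PartyMemory × (Fin d → List Bool)}
    (ht : b.1.time = b'.1.time) (hx : b.1.input = b'.1.input) (h : fullLog b = fullLog b') :
    b = b' := by
  have h := Encodable.encode_injective h
  simp only [Prod.mk.injEq] at h
  exact Prod.ext (PartyMemory.ext ht hx h.1 h.2.1) (List.ofFn_injective h.2.2)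

theorem eq_of_floodLog_eq {N d : ℕ} {b b' : PartyMemory × (Fin d → List Bool)}
    (ht : b.1.time = b'.1.time) (hx : b.1.input = b'.1.input)
    (h : floodLog N b = floodLog N b') (hm : merged N b = merged N b') : b = b' := by
  have h := Encodable.encode_injective h
  simp only [Prod.mk.injEq, hm] at h
  refine Prod.ext (PartyMemory.ext ht hx h.1 (mask_injective _ h.2.1)) (funext fun i => ?_)
  exact mask_injective _ (congrFun (List.ofFn_injective h.2.2) i)

open scoped Classical in
-- A full record determines the past. A flooding record does so together with the merged set, which
-- is in the new register, or in the record if it is no token, or else is encoded in orthogonal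
-- Fourier vectors.
theorem overlap_newRegister {N d : ℕ} {b b' : PartyMemory × (Fin d → List Bool)}
    (ht : b.1.time = b'.1.time) (hx : b.1.input = b'.1.input) (h : newLog N b = newLog N b') :
    overlap (newRegister N b) (newRegister N b') = if b = b' then 1 else 0 := by
  have of_full : fullLog b = fullLog b' → b = b' := eq_of_fullLog_eq ht hx
  have of_flood : floodLog N b = floodLog N b' → merged N b = merged N b' → b = b' :=
    eq_of_floodLog_eq ht hx
  unfold newLog at h
  unfold newRegister
  rw [← ht] at h ⊢
  rw [← hx]
  by_cases h0 : b.1.time = 0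
  · simp only [if_pos h0] at h ⊢
    rw [overlap_initialRegister, if_pos (of_full h)]
  simp only [if_neg h0] at h ⊢
  by_cases h1 : b.1.time ≤ N
  · simp only [if_pos h1] at h ⊢
    rw [overlap_single_one]
    exact if_congr ⟨of_flood h, fun hb => hb ▸ rfl⟩ rfl rfl
  simp only [if_neg h1] at h ⊢
  by_cases h2 : b.1.time = N + 1
  · simp only [if_pos h2] at h ⊢
    have h := Encodable.encode_injective h
    rw [Prod.mk.injEq] at h
    by_cases hβ : IsToken N (merged N b)
    · have hβ' : IsToken N (merged N b') := by
        by_contra hβ'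
        simp [hβ, hβ'] at h
      obtain ⟨β, hβ⟩ := hβ
      obtain ⟨β', hβ'⟩ := hβ'
      rw [hβ, hβ', overlap_fourierRegister]
      refine if_congr ⟨fun hββ => of_flood h.1 ?_, ?_⟩ rfl rfl
      · rw [hβ, hβ', hββ]
      · rintro rfl
        exact Option.some_injective _ (tokenSet_injective (hβ.symm.trans hβ'))
    · have hβ' : ¬ IsToken N (merged N b') := by
        intro hβ'
        simp [hβ, hβ'] at h
      rw [fourierRegister_of_not_isToken _ hβ, fourierRegister_of_not_isToken _ hβ',
        overlap_single_one, if_pos rfl, if_pos]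
      simp only [if_neg hβ, if_neg hβ', Option.some_inj] at h
      exact of_flood h.1 h.2
  · simp only [if_neg h2] at h ⊢
    obtain rfl := of_full h
    rw [overlap_single_one, if_pos rfl, if_pos rfl]

open scoped Classical in
-- Time, input and record survive as basis labels of the result, so a difference in them makes the
-- supports disjoint.
theorem overlap_evolve (N din dout : ℕ) (b b' : PartyMemory × (Fin din → List Bool)) :
    overlap (evolve N din dout b) (evolve N din dout b') = if b = b' then 1 else 0 := by
  unfold evolve
  by_cases h : b.1.time = b'.1.time ∧ b.1.input = b'.1.input ∧ newLog N b = newLog N b'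
  · have he : emit N dout b = emit N dout b' := by
      funext c
      simp only [emit, h.1, h.2.1, h.2.2]
    rw [he, overlap_mapDomain, overlap_newRegister h.1 h.2.1 h.2.2]
    intro c c' hc
    exact congrArg (fun q => q.1.register) hc
  · rw [if_neg (by rintro rfl; exact h ⟨rfl, rfl, rfl⟩)]
    refine overlap_eq_zero_of_disjoint fun q hq => ?_
    by_contra hq'
    have key : ∀ {b : PartyMemory × (Fin din → List Bool)},
        Finsupp.mapDomain (emit N dout b) (newRegister N b) q ≠ 0 → ∃ c, emit N dout b c = q := by
      intro b hb
      obtain ⟨c, -, hc⟩ := Finset.mem_image.1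
        (Finsupp.mapDomain_support (Finsupp.mem_support_iff.2 hb))
      exact ⟨c, hc⟩
    obtain ⟨c, rfl⟩ := key hq
    obtain ⟨c', hc'⟩ := key hq'
    have := congrArg Prod.fst hc'
    simp only [emit, PartyMemory.mk.injEq, add_left_inj] at this
    exact h ⟨this.1.symm, this.2.1.symm, this.2.2.1.symm⟩

end PartyMemory

/-! ### The algorithm and its acceptance criterion. -/

/-- The final register of a party is a view that arises when exactly one party is active. -/
def PartyMemory.Accepts (q : PartyMemory) : Prop :=
  ∃ (N n m : ℕ) (G : MultiDigraph n m) (P : PortNumbering G) (x : Fin n → Bool)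
    (j : Fin n → FourierIndex N) (v : Fin n),
    (Finset.univ.filter fun u => x u = true).card = 1 ∧ q.time = 5 * N ∧
      q.register = P.view (fun u => ((x u, some (j u)) : Label N)) (4 * N - 2) v

open scoped Classical in
def solitudeAlgorithm : QuantumAlgorithm where
  Mem := PartyMemory
  Outcome := Unit
  rounds N := 5 * N
  start _ _ _ x := ⟨0, x, 0, ∅⟩
  kraus N din dout _ b := PartyMemory.evolve N din dout b
  tracePreserving N din dout b b' := by
    simp only [PartyMemory.overlap_evolve]
    exact hasSum_unique fun _ : Unit => if b = b' then (1 : ℂ) else 0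
  output q := decide q.Accepts

instance : Unique solitudeAlgorithm.Outcome := inferInstanceAs (Unique Unit)

/-! ### The run of the algorithm on a network. -/

namespace SolitudeVerification

open PartyMemory QuantumAlgorithm

variable {n m : ℕ} {G : MultiDigraph n m} (P : PortNumbering G) (N : ℕ) (x : Fin n → Bool)

/-- The basis state of the network at time `t` in which the parties have the given records and
registers and have just sent their registers. -/
def config (t : ℕ) (lg : Fin n → ℕ) (r : Fin n → Finset ℕ) : solitudeAlgorithm.Config n m :=
  (fun v => ⟨t, x v, lg v, r v⟩,
    fun e => codeword N (if t ≤ N + 1 then 0 else P.port e, r (G.src e)))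

theorem config_message (t : ℕ) (lg : Fin n → ℕ) (r : Fin n → Finset ℕ) (e : Fin m) :
    (config P N x t lg r).2 e = codeword N (if t ≤ N + 1 then 0 else P.port e, r (G.src e)) :=
  rfl

/-- What party `v` has access to at the beginning of a round. -/
def inbox (c : solitudeAlgorithm.Config n m) (v : Fin n) :
    PartyMemory × (Fin (G.inDeg v) → List Bool) :=
  solitudeAlgorithm.received P c v

/-- Independent local superpositions become one over joint choices `z`; the records are the same for
all `z`. -/
theorem round_single_config {t : ℕ} (k : Fin n → solitudeAlgorithm.Outcome)
    {c : solitudeAlgorithm.Config n m} (ht : ∀ v, (inbox P c v).1.time = t)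
    (hx : ∀ v, (inbox P c v).1.input = x v) {τ : Type} {S : Fin n → Finset τ} {a : Fin n → τ → ℂ}
    {r : Fin n → τ → Finset ℕ}
    (h : ∀ v, newRegister N (inbox P c v) = ∑ i ∈ S v, a v i • Finsupp.single (r v i) 1) :
    solitudeAlgorithm.round P N k (Finsupp.single c 1) =
      ∑ z ∈ Fintype.piFinset S, (∏ v, a v (z v)) • Finsupp.single
        (config P N x (t + 1) (fun v => newLog N (inbox P c v)) fun v => r v (z v)) (1 : ℂ) := by
  rw [solitudeAlgorithm.round_single P (S := S) (a := a)
    (g := fun v i => emit N (G.outDeg v) (inbox P c v) (r v i))]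
  · refine Finset.sum_congr rfl fun z _ => ?_
    congr 2
    refine Prod.ext (funext fun v => ?_) (funext fun e => ?_)
    · exact PartyMemory.ext (congrArg (· + 1) (ht v)) (hx v) rfl rfl
    · simp only [send, emit, config, ht, Nat.add_le_add_iff_right, PortNumbering.port]
  · intro v
    change evolve N _ _ (inbox P c v) = _
    rw [evolve, h, Finsupp.mapDomain_finsetSum]
    simp only [Finsupp.mapDomain_smul, Finsupp.mapDomain_single]
    rfl

theorem round_single_config_of_deterministic {t : ℕ} (k : Fin n → solitudeAlgorithm.Outcome)
    {c : solitudeAlgorithm.Config n m} (ht : ∀ v, (inbox P c v).1.time = t)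
    (hx : ∀ v, (inbox P c v).1.input = x v) {r : Fin n → Finset ℕ}
    (h : ∀ v, newRegister N (inbox P c v) = Finsupp.single (r v) 1) :
    solitudeAlgorithm.round P N k (Finsupp.single c 1) = Finsupp.single
        (config P N x (t + 1) (fun v => newLog N (inbox P c v)) r) (1 : ℂ) := by
  rw [round_single_config P N x k ht hx (τ := Unit) (S := fun _ => {()}) (a := fun _ _ => 1)
    (r := fun v _ => r v) (by simpa using h)]
  simp [Fintype.piFinset_singleton]

theorem merged_received (t : ℕ) (lg : Fin n → ℕ) (r : Fin n → Finset ℕ)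
    (v : Fin n) :
    merged N (inbox P (config P N x t lg r) v) =
      r v ∪ Finset.univ.biUnion fun i => r (G.src (P.inEdge v i)) := by
  simp only [merged, inbox, received, config, decodeword_codeword, PortNumbering.inEdge]

section Flooding

variable {N}

/-- The tokens that party `v` has seen after `t` rounds of flooding. -/
def seen (G : MultiDigraph n m) (z : Fin n → Option (Finset (Fin N))) (t : ℕ) (v : Fin n) :
    Finset ℕ :=
  Finset.univ.biUnion fun u => tokenSet (if v ∈ G.ball u t then z u else none)

variable {z : Fin n → Option (Finset (Fin N))}

theorem mem_seen {t : ℕ} {v : Fin n} {a : ℕ} :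
    a ∈ seen G z t v ↔ ∃ u, v ∈ G.ball u t ∧ a ∈ tokenSet (z u) := by
  simp only [seen, Finset.mem_biUnion, Finset.mem_univ, true_and]
  refine exists_congr fun u => ?_
  by_cases h : v ∈ G.ball u t <;> simp [h, tokenSet]

theorem seen_zero (v : Fin n) : seen G z 0 v = tokenSet (z v) := by
  ext a
  simp [mem_seen, MultiDigraph.ball]

theorem seen_succ (t : ℕ) (v : Fin n) :
    seen G z t v ∪ (Finset.univ.biUnion fun i => seen G z t (G.src (P.inEdge v i))) =
      seen G z (t + 1) v := by
  ext a
  simp only [Finset.mem_union, Finset.mem_biUnion, Finset.mem_univ, true_and, mem_seen,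
    G.mem_ball_succ]
  constructor
  · rintro (⟨u, hu, ha⟩ | ⟨i, u, hu, ha⟩)
    · exact ⟨u, Or.inl hu, ha⟩
    · exact ⟨u, Or.inr ⟨_, P.dst_inEdge v i, hu⟩, ha⟩
  · rintro ⟨u, hu | ⟨e, rfl, hu⟩, ha⟩
    · exact Or.inl ⟨u, hu, ha⟩
    · obtain ⟨i, hi⟩ := P.exists_inEdge_eq e
      exact Or.inr ⟨i, u, by rwa [hi], ha⟩

theorem seen_eq_of_le (hG : G.StronglyConnected) {t : ℕ} (ht : n ≤ t) (v : Fin n) :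
    seen G z t v = Finset.univ.biUnion fun u => tokenSet (z u) := by
  ext a
  simp [mem_seen, G.ball_eq_univ hG _ ht]

/-- The basis state after `t` rounds of flooding. -/
def floodConfig (z : Fin n → Option (Finset (Fin N))) : ℕ → solitudeAlgorithm.Config n m
  | 0 => config P N x 1 (fun v => fullLog (d := G.inDeg v) (⟨0, x v, 0, ∅⟩, fun _ => []))
      (seen G z 0)
  | t + 1 => config P N x (t + 2)
      (fun v => floodLog N (inbox P (floodConfig z t) v)) (seen G z (t + 1))

theorem exists_floodConfig_eq (z : Fin n → Option (Finset (Fin N))) (t : ℕ) :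
    ∃ lg, floodConfig P x z t = config P N x (t + 1) lg (seen G z t) := by
  cases t <;> exact ⟨_, rfl⟩

theorem merged_floodConfig (z : Fin n → Option (Finset (Fin N))) (t : ℕ)
    (v : Fin n) :
    merged N (inbox P (floodConfig P x z t) v) = seen G z (t + 1) v := by
  obtain ⟨lg, h⟩ := exists_floodConfig_eq P x z t
  rw [h, merged_received, seen_succ]

theorem inbox_floodConfig_time (z : Fin n → Option (Finset (Fin N))) (t : ℕ) (v : Fin n) :
    (inbox P (floodConfig P x z t) v).1.time = t + 1 := by
  obtain ⟨lg, h⟩ := exists_floodConfig_eq P x z t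
  rw [h]
  rfl

theorem inbox_floodConfig_input (z : Fin n → Option (Finset (Fin N))) (t : ℕ) (v : Fin n) :
    (inbox P (floodConfig P x z t) v).1.input = x v := by
  obtain ⟨lg, h⟩ := exists_floodConfig_eq P x z t
  rw [h]
  rfl

theorem round_floodConfig (k : Fin n → solitudeAlgorithm.Outcome)
    (z : Fin n → Option (Finset (Fin N))) {t : ℕ} (ht : t < N) :
    solitudeAlgorithm.round P N k (Finsupp.single (floodConfig P x z t) 1) =
      Finsupp.single (floodConfig P x z (t + 1)) 1 := by
  have hm := merged_floodConfig P x z t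
  have htime := inbox_floodConfig_time P x z t
  have hinput := inbox_floodConfig_input P x z t
  rw [round_single_config_of_deterministic P N x k htime hinput (r := seen G z (t + 1))]
  · rw [floodConfig]
    congr 3
    funext v
    rw [newLog, if_neg (by rw [htime]; omega), if_pos (by rw [htime]; omega)]
  · intro v
    rw [newRegister, if_neg (by rw [htime]; omega), if_pos (by rw [htime]; omega), hm]

/-- During the first phase the network is in a superposition of the floodings that belong to all
choices of tokens. -/
theorem state_flood {t : ℕ} (ht : t ≤ N) (o : Fin (t + 1) → Fin n → solitudeAlgorithm.Outcome) :
    solitudeAlgorithm.state P N x (t + 1) o =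
      ∑ z ∈ Fintype.piFinset fun v => tokenChoices N (x v),
        (∏ v, tokenAmplitude N (x v)) • Finsupp.single (floodConfig P x z t) 1 := by
  induction t with
  | zero =>
    rw [state, state, round_single_config P N x (t := 0) (τ := Option (Finset (Fin N)))
      (S := fun v => tokenChoices N (x v)) (a := fun v _ => tokenAmplitude N (x v))
      (r := fun v => tokenSet) _ (fun _ => rfl) (fun _ => rfl) (fun _ => rfl)]
    refine Finset.sum_congr rfl fun z _ => ?_
    rw [floodConfig, funext fun v => seen_zero (G := G) (z := z) v]
    rfl
  | succ t ih =>
    rw [state, ih (by omega) (Fin.init o), round_sum]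
    refine Finset.sum_congr rfl fun z _ => ?_
    rw [round_floodConfig P x _ z (by omega)]

end Flooding
variable {N}

/-- All active parties have chosen the token `β`. -/
def commonToken (x : Fin n → Bool) (β : Finset (Fin N)) (v : Fin n) :
    Option (Finset (Fin N)) :=
  if x v then some β else none

open scoped Classical in
theorem seen_commonToken (β : Finset (Fin N)) (t : ℕ) (v : Fin n) :
    seen G (commonToken x β) t v =
      if ∃ u, v ∈ G.ball u t ∧ x u = true then tokenSet (some β) else ∅ := by
  ext a
  rw [mem_seen]
  split_ifs with h
  · obtain ⟨u, hu, hx⟩ := h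
    refine ⟨?_, fun ha => ⟨u, hu, by rwa [commonToken, if_pos hx]⟩⟩
    rintro ⟨w, -, ha⟩
    unfold commonToken at ha
    split_ifs at ha
    · exact ha
    · simp [tokenSet] at ha
  · refine ⟨?_, fun ha => by simp at ha⟩
    rintro ⟨u, hu, ha⟩
    unfold commonToken at ha
    split_ifs at ha with hx
    · exact absurd ⟨u, hu, hx⟩ h
    · simp [tokenSet] at ha

/-- With a common token, a seen set is empty or is the token itself. If the set at `v` is the token,
so is the reference set at `w`, and the mask hides it; otherwise the masked value can only show
emptiness. -/
theorem mask_seen_commonToken {α : Type} [DecidableEq α] {f : Finset ℕ → α}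
    (hf : Function.Injective f) (β β' : Finset (Fin N)) {s t : ℕ} {v w : Fin n}
    (h : ∀ u, v ∈ G.ball u s → w ∈ G.ball u t) :
    mask (f (seen G (commonToken x β) t w)) (f (seen G (commonToken x β) s v)) =
      mask (f (seen G (commonToken x β') t w)) (f (seen G (commonToken x β') s v)) := by
  classical
  have hne : ∀ β : Finset (Fin N), f ∅ ≠ f (tokenSet (some β)) := fun β h => by
    simpa [tokenSet] using (hf h).symm
  have hpq : (∃ u, v ∈ G.ball u s ∧ x u = true) → ∃ u, w ∈ G.ball u t ∧ x u = true :=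
    fun ⟨u, hu, hx⟩ => ⟨u, h u hu, hx⟩
  simp only [seen_commonToken]
  by_cases hp : ∃ u, v ∈ G.ball u s ∧ x u = true
  · simp only [if_pos hp, if_pos (hpq hp), mask, if_true]
  · by_cases hq : ∃ u, w ∈ G.ball u t ∧ x u = true
    · simp only [if_neg hp, if_pos hq, mask, if_neg (hne _)]
    · simp only [if_neg hp, if_neg hq]

/-- While only one token is in the network, the records do not reveal it. -/
theorem floodLog_commonToken (β β' : Finset (Fin N)) {t : ℕ} (ht : t ≤ N) (v : Fin n) :
    floodLog N (inbox P (floodConfig P x (commonToken x β) t) v) =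
      floodLog N (inbox P (floodConfig P x (commonToken x β') t) v) := by
  classical
  have hreg : ∀ (β : Finset (Fin N)) t v,
      (inbox P (floodConfig P x (commonToken x β) t) v).1.register =
        seen G (commonToken x β) t v := fun β t v => by
    obtain ⟨lg, h⟩ := exists_floodConfig_eq P x (commonToken x β) t
    rw [h]
    rfl
  have hmsg : ∀ (β : Finset (Fin N)) t v i, t ≤ N →
      (inbox P (floodConfig P x (commonToken x β) t) v).2 i =
        codeword N (0, seen G (commonToken x β) t (G.src (P.inEdge v i))) := fun β t v i ht => by
    obtain ⟨lg, h⟩ := exists_floodConfig_eq P x (commonToken x β) t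
    rw [h]
    simp [inbox, received, config, PortNumbering.inEdge, ht]
  have key : ∀ t ≤ N, (∀ v, (inbox P (floodConfig P x (commonToken x β) t) v).1.log =
        (inbox P (floodConfig P x (commonToken x β') t) v).1.log) → ∀ v,
      floodLog N (inbox P (floodConfig P x (commonToken x β) t) v) =
        floodLog N (inbox P (floodConfig P x (commonToken x β') t) v) := by
    intro t ht hlog v
    unfold floodLog
    rw [hlog, merged_floodConfig, merged_floodConfig, hreg, hreg,
      mask_seen_commonToken x (f := fun c => c) (fun _ _ h => h) β β' fun u hu =>
        G.mem_ball_succ.2 (Or.inl hu)]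
    congr 5
    funext i
    rw [hmsg _ t v i ht, hmsg _ t v i ht]
    exact mask_seen_commonToken x (f := fun c => codeword N (0, c))
      (fun c c' h => congrArg Prod.snd (codeword_injective N h)) β β' fun u hu =>
        G.mem_ball_succ.2 (Or.inr ⟨_, P.dst_inEdge v i, hu⟩)
  induction t generalizing v with
  | zero => exact key 0 ht (fun _ => rfl) v
  | succ t ih => exact key (t + 1) ht (fun v => ih (by omega) v) v

/-! ### Interference at the Fourier transform. -/

/-- The number of active parties. -/
def activeCount (x : Fin n → Bool) : ℕ := (Finset.univ.filter fun v => x v = true).card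

/-- The labels that can be observed after the Fourier transform. -/
def Admissible (x : Fin n → Bool) (ℓ : Fin n → Label N) : Prop :=
  (activeCount x ≠ 1 ∧ ℓ = fun v => (x v, none)) ∨
    ∃ j : Fin n → FourierIndex N, 0 < activeCount x ∧
      ∑ β : Finset (Fin N), ∏ v, phase (x v) β (j v) ≠ 0 ∧ ℓ = fun v => (x v, some (j v))

theorem mem_piFinset_tokenChoices {z : Fin n → Option (Finset (Fin N))} :
    (z ∈ Fintype.piFinset fun v => tokenChoices N (x v)) ↔ ∀ v, (z v).isSome = x v := by
  rw [Fintype.mem_piFinset]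
  refine forall_congr' fun v => ?_
  cases x v <;> cases z v <;> simp [tokenChoices]

theorem eq_commonToken {z : Fin n → Option (Finset (Fin N))} (hz : ∀ v, (z v).isSome = x v)
    {β : Finset (Fin N)}
    (hβ : (Finset.univ.biUnion fun u => tokenSet (z u)) = tokenSet (some β)) :
    z = commonToken x β := by
  funext v
  rw [commonToken, ← hz v]
  rcases h : z v with _ | γ
  · simp
  · have : Encodable.encode γ ∈ tokenSet (some β) := by
      rw [← hβ]
      exact Finset.mem_biUnion.2 ⟨v, Finset.mem_univ v, by simp [h, tokenSet]⟩
    simpa [tokenSet] using this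

theorem biUnion_commonToken {a : Fin n} (ha : x a = true) (β : Finset (Fin N)) :
    (Finset.univ.biUnion fun u => tokenSet (commonToken x β u)) = tokenSet (some β) := by
  ext i
  simp only [Finset.mem_biUnion, Finset.mem_univ, true_and]
  refine ⟨?_, fun h => ⟨a, by rwa [commonToken, if_pos ha]⟩⟩
  rintro ⟨u, hu⟩
  unfold commonToken at hu
  split_ifs at hu
  · exact hu
  · simp [tokenSet] at hu

theorem isToken_of_activeCount_eq_one {z : Fin n → Option (Finset (Fin N))}
    (hz : ∀ v, (z v).isSome = x v) (hx : activeCount x = 1) :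
    IsToken N (Finset.univ.biUnion fun u => tokenSet (z u)) := by
  obtain ⟨a, ha⟩ := Finset.card_eq_one.1 hx
  have ha' : ∀ u, x u = true ↔ u = a := fun u => by
    simpa using congrArg (u ∈ ·) ha
  obtain ⟨β, hβ⟩ := Option.isSome_iff_exists.1 ((hz a).trans ((ha' a).2 rfl))
  refine ⟨β, ?_⟩
  rw [← biUnion_commonToken x ((ha' a).2 rfl) β]
  congr 1
  funext u
  by_cases hu : u = a
  · rw [hu, hβ, commonToken, if_pos ((ha' a).2 rfl)]
  · have hxu : x u = false := by simpa [hu] using ha' u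
    have := hz u
    rw [hxu] at this
    simp only [Option.isSome_eq_false_iff, Option.isNone_iff_eq_none] at this
    rw [this, commonToken, hxu]
    rfl

theorem merged_last (hG : G.StronglyConnected) (hn : n ≤ N)
    (z : Fin n → Option (Finset (Fin N))) (v : Fin n) :
    merged N (inbox P (floodConfig P x z N) v) = Finset.univ.biUnion fun u => tokenSet (z u) := by
  rw [merged_floodConfig, seen_eq_of_le hG (by omega)]

theorem round_fourier_of_not_isToken (hG : G.StronglyConnected) (hn : n ≤ N)
    (k : Fin n → solitudeAlgorithm.Outcome) {z : Fin n → Option (Finset (Fin N))}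
    (hz : ¬ IsToken N (Finset.univ.biUnion fun u => tokenSet (z u))) :
    solitudeAlgorithm.round P N k (Finsupp.single (floodConfig P x z N) 1) =
      Finsupp.single (config P N x (N + 2) (fun v => newLog N (inbox P (floodConfig P x z N) v))
        (P.view (fun v => ((x v, none) : Label N)) 0)) 1 := by
  have htime := inbox_floodConfig_time P x z N
  have hinput := inbox_floodConfig_input P x z N
  refine round_single_config_of_deterministic P N x k htime hinput fun v => ?_
  rw [newRegister, if_neg (by rw [htime]; omega), if_neg (by rw [htime]; omega),
    if_pos (htime v), merged_last P x hG hn, fourierRegister_of_not_isToken _ hz, hinput]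
  rfl

/-- The records `lg` are fixed before `β`: this lets the branches of different common tokens
interfere. -/
theorem exists_round_fourier (hG : G.StronglyConnected) (hn : n ≤ N)
    (k : Fin n → solitudeAlgorithm.Outcome) {a : Fin n} (ha : x a = true) :
    ∃ lg : Fin n → ℕ, ∀ β : Finset (Fin N),
      solitudeAlgorithm.round P N k (Finsupp.single (floodConfig P x (commonToken x β) N) 1) =
        ∑ j : Fin n → FourierIndex N, (∏ v, fourierAmplitude (x v) β (j v)) •
          Finsupp.single (config P N x (N + 2) lg
            (P.view (fun v => ((x v, some (j v)) : Label N)) 0)) 1 := by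
  classical
  -- Any token gives the same records by `floodLog_commonToken`; the token `∅` serves as reference.
  refine ⟨fun v => newLog N (inbox P (floodConfig P x (commonToken x (∅ : Finset (Fin N))) N) v),
    fun β => ?_⟩
  have hlog : ∀ v, newLog N (inbox P (floodConfig P x (commonToken x β) N) v) =
      newLog N (inbox P (floodConfig P x (commonToken x (∅ : Finset (Fin N))) N) v) := by
    intro v
    have hnew : ∀ β : Finset (Fin N), newLog N (inbox P (floodConfig P x (commonToken x β) N) v) =
        Encodable.encode (floodLog N (inbox P (floodConfig P x (commonToken x β) N) v),
          (none : Option (Finset ℕ))) := by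
      intro β
      have htime := inbox_floodConfig_time P x (commonToken x β) N
      rw [newLog, if_neg (by rw [htime]; omega), if_neg (by rw [htime]; omega),
        if_pos (htime v), if_pos]
      rw [merged_last P x hG hn]
      exact ⟨β, biUnion_commonToken x ha β⟩
    rw [hnew, hnew, floodLog_commonToken P x β ∅ le_rfl]
  have htime := inbox_floodConfig_time P x (commonToken x β) N
  have hinput := inbox_floodConfig_input P x (commonToken x β) N
  rw [round_single_config P N x k htime hinput (S := fun _ => Finset.univ)
    (a := fun v (j : FourierIndex N) => fourierAmplitude (x v) β j)
    (r := fun v j => {Encodable.encode ((x v, some j) : Label N)})]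
  · rw [Fintype.piFinset_univ]
    simp only [hlog]
    rfl
  · intro v
    rw [newRegister, if_neg (by rw [htime]; omega), if_neg (by rw [htime]; omega),
      if_pos (htime v), merged_last P x hG hn, biUnion_commonToken x ha, fourierRegister_tokenSet,
      hinput]

theorem exists_admissible_of_mem_support (hG : G.StronglyConnected) (hn : n ≤ N)
    (o : Fin (N + 2) → Fin n → solitudeAlgorithm.Outcome) {d : solitudeAlgorithm.Config n m}
    (hd : d ∈ (solitudeAlgorithm.state P N x (N + 2) o).support) :
    ∃ (ℓ : Fin n → Label N) (lg : Fin n → ℕ), Admissible x ℓ ∧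
      d = config P N x (N + 2) lg (P.view ℓ 0) := by
  classical
  have single_ne : ∀ {w : ℂ} {c : solitudeAlgorithm.Config n m},
      (w • Finsupp.single c (1 : ℂ)) d ≠ 0 → d = c ∧ w ≠ 0 := by
    intro w c h
    rw [Finsupp.smul_apply, Finsupp.single_apply] at h
    split_ifs at h with hc
    · exact ⟨hc.symm, by simpa using h⟩
    · simp at h
  set w : ℂ := ∏ v, tokenAmplitude N (x v)
  set Z := Fintype.piFinset fun v => tokenChoices N (x v)
  set Tok : (Fin n → Option (Finset (Fin N))) → Prop := fun z =>
    IsToken N (Finset.univ.biUnion fun u => tokenSet (z u)) with hTok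
  rw [Finsupp.mem_support_iff, state, state_flood P x le_rfl, round_sum,
    ← Finset.sum_filter_add_sum_filter_not Z Tok, Finsupp.add_apply] at hd
  -- Either only branches with exactly one token contribute at `d`, or some other branch reaches
  -- `d`, and that one puts the label `none` everywhere.
  by_cases h0 : (∑ z ∈ Z with ¬ Tok z, w • solitudeAlgorithm.round P N (o (Fin.last (N + 1)))
      (Finsupp.single (floodConfig P x z N) 1)) d = 0
  · rw [h0, add_zero] at hd
    obtain ⟨z₀, hz₀⟩ : (Z.filter Tok).Nonempty := by
      by_contra h
      rw [Finset.not_nonempty_iff_eq_empty] at h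
      rw [h, Finset.sum_empty] at hd
      exact hd rfl
    rw [Finset.mem_filter, mem_piFinset_tokenChoices] at hz₀
    obtain ⟨a, ha⟩ : ∃ a, x a = true := by
      obtain ⟨β, hβ⟩ := hz₀.2
      have : Encodable.encode β ∈ Finset.univ.biUnion fun u => tokenSet (z₀ u) := by
        rw [hβ]
        simp [tokenSet]
      obtain ⟨a, -, ha⟩ := Finset.mem_biUnion.1 this
      refine ⟨a, ?_⟩
      rw [← hz₀.1 a]
      rcases h : z₀ a with _ | γ
      · simp [h, tokenSet] at ha
      · rfl
    have hfilter : Z.filter Tok = Finset.univ.image (commonToken x) := by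
      ext z
      rw [Finset.mem_filter, mem_piFinset_tokenChoices, Finset.mem_image]
      constructor
      · rintro ⟨hz, β, hβ⟩
        exact ⟨β, Finset.mem_univ β, (eq_commonToken x hz hβ).symm⟩
      · rintro ⟨β, -, rfl⟩
        refine ⟨fun v => ?_, β, biUnion_commonToken x ha β⟩
        unfold commonToken
        cases x v <;> simp
    have hinj : Function.Injective (commonToken (N := N) x) := fun β β' h => by
      simpa [commonToken, ha] using congrFun h a
    obtain ⟨lg, hlg⟩ := exists_round_fourier P x hG hn (o (Fin.last (N + 1))) ha
    rw [hfilter, Finset.sum_image fun _ _ _ _ h => hinj h] at hd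
    simp only [hlg, Finset.smul_sum, smul_smul] at hd
    -- With the sum over `j` outside, the inner sum over `β` is the amplitude of an outcome.
    rw [Finset.sum_comm] at hd
    simp only [← Finset.sum_smul, Finsupp.finsetSum_apply] at hd
    obtain ⟨j, -, hj⟩ := Finset.exists_ne_zero_of_sum_ne_zero hd
    obtain ⟨rfl, hj⟩ := single_ne hj
    refine ⟨_, lg, Or.inr ⟨j, Finset.card_pos.2 ⟨a, by simpa using ha⟩, fun h => hj ?_, rfl⟩, rfl⟩
    simp only [fourierAmplitude, Finset.prod_mul_distrib, ← Finset.mul_sum, h, mul_zero, zero_smul,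
      Finsupp.coe_zero, Pi.zero_apply]
  · rw [Finsupp.finsetSum_apply] at h0
    obtain ⟨z, hz, hne⟩ := Finset.exists_ne_zero_of_sum_ne_zero h0
    rw [Finset.mem_filter, mem_piFinset_tokenChoices] at hz
    rw [round_fourier_of_not_isToken P x hG hn _ hz.2] at hne
    exact ⟨_, _, Or.inl ⟨fun h => hz.2 (isToken_of_activeCount_eq_one x hz.1 h), rfl⟩,
      (single_ne hne).1⟩

/-- In the second phase the parties build up views. -/
theorem exists_view_of_mem_support (hG : G.StronglyConnected) (hn : n ≤ N) (t : ℕ)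
    (o : Fin (N + 2 + t) → Fin n → solitudeAlgorithm.Outcome) {d : solitudeAlgorithm.Config n m}
    (hd : d ∈ (solitudeAlgorithm.state P N x (N + 2 + t) o).support) :
    ∃ (ℓ : Fin n → Label N) (lg : Fin n → ℕ), Admissible x ℓ ∧
      d = config P N x (N + 2 + t) lg (P.view ℓ t) := by
  induction t generalizing d with
  | zero => exact exists_admissible_of_mem_support P x hG hn o hd
  | succ t ih =>
    obtain ⟨c, hc, hd⟩ := exists_mem_support_of_mem_support_round _ P hd
    obtain ⟨ℓ, lg, hℓ, rfl⟩ := ih (Fin.init o) hc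
    set c := config P N x (N + 2 + t) lg (P.view ℓ t) with hc
    have htime : ∀ v, (inbox P c v).1.time = N + 2 + t := fun _ => rfl
    rw [round_single_config_of_deterministic P N x _ htime (fun _ => rfl)
      (r := P.view ℓ (t + 1))] at hd
    · exact ⟨ℓ, fun v => newLog N (inbox P c v), hℓ,
        Finset.mem_singleton.1 (Finsupp.support_single_subset hd)⟩
    · intro v
      rw [newRegister, if_neg (by rw [htime]; omega), if_neg (by rw [htime]; omega),
        if_neg (by rw [htime]; omega), P.view_succ]
      simp only [hc, inbox, received, config, decodeword_codeword, PortNumbering.inEdge,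
        if_neg (show ¬ N + 2 + t ≤ N + 1 by omega)]

/-! ### Correctness of the answer. -/

theorem accepts_iff (hG : G.StronglyConnected) (hn1 : 1 ≤ n) (hn : n ≤ N) {ℓ : Fin n → Label N}
    (hℓ : Admissible x ℓ) (lg : ℕ) (v : Fin n) :
    Accepts ⟨5 * N, x v, lg, P.view ℓ (4 * N - 2) v⟩ ↔ activeCount x = 1 := by
  constructor
  · rintro ⟨N', n', m', G', P', x', j', v', hx', hN, hview⟩
    -- `output` is not given `N`; the final time `5 * N` reveals it.
    obtain rfl : N = N' := by
      dsimp only at hN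
      omega
    dsimp only at hview
    by_contra hne
    have hlab := P.label_eq_of_view_eq ℓ P' _ hview
    rcases hℓ with ⟨-, rfl⟩ | ⟨j, hpos, hj, rfl⟩
    · simp at hlab
    refine hj (sum_prod_phase_eq_zero P hG x j (t := N) (P.viewStable _ hn1 hn) ?_ ?_ ?_)
    · unfold activeCount at hpos hne
      omega
    · refine (Finset.card_le_univ _).trans ?_
      rwa [Fintype.card_fin]
    · obtain ⟨b, hb⟩ := Finset.card_eq_one.1 hx'
      have hb' : ∀ u, x' u = true → u = b := fun u hu => by
        simpa [hu] using congrArg (u ∈ ·) hb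
      have key : ∀ u, x u = true → P.view (fun v => ((x v, some (j v)) : Label N)) N u =
          P'.view (fun v => ((x' v, some (j' v)) : Label N)) N b := by
        intro u hu
        -- Of the depth `4 * N - 2`, the part `3 * N - 2 ≥ n` suffices to reach every node, and
        -- depth `N` is left for stable views.
        have hball : v ∈ G.ball u (3 * N - 2) := by
          rw [G.ball_eq_univ hG u (by omega)]
          exact Finset.mem_univ v
        obtain ⟨u', hu'⟩ := P.exists_view_eq_of_mem_ball _ P' _ (s := N) hball (v' := v') (by
          rwa [show N + (3 * N - 2) = 4 * N - 2 by omega])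
        have hl := P.label_eq_of_view_eq _ P' _ hu'
        rw [hu', hb' u' ((congrArg Prod.fst hl).symm.trans hu)]
      exact fun u w hu hw => (key u hu).trans (key w hw).symm
  · intro hx
    rcases hℓ with ⟨h, -⟩ | ⟨j, -, -, rfl⟩
    · exact absurd hx h
    · exact ⟨N, n, m, G, P, x, j, v, hx, rfl, rfl⟩

theorem solitudeAlgorithm_probAnswer (hG : G.StronglyConnected) (hn1 : 1 ≤ n) (hn : n ≤ N) :
    solitudeAlgorithm.probAnswer P N x (hammingIs 1 x) = 1 := by
  classical
  refine solitudeAlgorithm.probAnswer_eq_one P (fun din dout _ b b' => ?_) fun o d hd v => ?_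
  · exact (overlap_evolve N din dout b b').trans (by congr)
  · have hrounds : solitudeAlgorithm.rounds N = N + 2 + (4 * N - 2) := by
      change 5 * N = _
      omega
    obtain ⟨ℓ, lg, hℓ, rfl⟩ : ∃ (ℓ : Fin n → Label N) (lg : Fin n → ℕ), Admissible x ℓ ∧
        d = config P N x (5 * N) lg (P.view ℓ (4 * N - 2)) := by
      have h5 : 5 * N = N + 2 + (4 * N - 2) := hrounds
      rw [h5]
      revert o
      rw [hrounds]
      exact fun o hd => exists_view_of_mem_support P x hG hn _ o hd
    change decide (Accepts ⟨5 * N, x v, lg v, P.view ℓ (4 * N - 2) v⟩) = _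
    rw [hammingIs]
    exact decide_eq_decide.2 (accepts_iff P x hG hn1 hn hℓ (lg v) v)

/-! ### The communication bound. -/

theorem length_message_le (hG : G.StronglyConnected) (hn : n ≤ N) (hm : m ≤ N ^ 2) {t : ℕ}
    (ht : t < 5 * N) (o : Fin (t + 1) → Fin n → solitudeAlgorithm.Outcome)
    {d : solitudeAlgorithm.Config n m}
    (hd : d ∈ (solitudeAlgorithm.state P N x (t + 1) o).support) (e : Fin m) :
    (d.2 e).length ≤ codeLength N + 1 := by
  classical
  by_cases h : t ≤ N
  · rw [state_flood P x h] at hd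
    obtain ⟨z, -, hz⟩ := Finset.mem_biUnion.1 (Finsupp.support_finsetSum hd)
    obtain rfl := Finset.mem_singleton.1
      (Finsupp.support_single_subset (Finsupp.support_smul hz))
    obtain ⟨lg, hlg⟩ := exists_floodConfig_eq P x z t
    rw [hlg, config_message, if_pos (by omega)]
    -- Erasing the tokens that have not yet arrived turns a partial flooding into a `Situation`.
    exact length_codeword_le (.inl ⟨⟨n, by omega⟩,
      fun u => if G.src e ∈ G.ball u t then z u else none⟩)
  · obtain ⟨s, rfl⟩ : ∃ s, t = N + 1 + s := ⟨t - (N + 1), by omega⟩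
    have hs : N + 1 + s + 1 = N + 2 + s := by omega
    obtain ⟨ℓ, lg, -, rfl⟩ : ∃ (ℓ : Fin n → Label N) (lg : Fin n → ℕ), Admissible x ℓ ∧
        d = config P N x (N + 2 + s) lg (P.view ℓ s) := by
      revert o
      rw [hs]
      exact fun o hd => exists_view_of_mem_support P x hG hn _ o hd
    rw [config_message, if_neg (by omega)]
    exact length_codeword_le (.inr ⟨⟨n, by omega⟩, ⟨m, by omega⟩, ⟨G, P⟩, ℓ, e, ⟨s, by omega⟩⟩)

theorem bitsSent_le (hG : G.StronglyConnected) (hn : n ≤ N) (hm : m ≤ N ^ 2) :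
    ∀ {t : ℕ}, t ≤ 5 * N → ∀ o : Fin t → Fin n → solitudeAlgorithm.Outcome,
      solitudeAlgorithm.bitsSent P N x t o ≤ t * (N ^ 2 * (codeLength N + 1))
  | 0, _, _ => by simp [bitsSent]
  | t + 1, ht, o => by
    rw [bitsSent, Nat.succ_mul]
    refine Nat.add_le_add (bitsSent_le hG hn hm (by omega) _) ?_
    refine (Finset.sum_le_card_nsmul _ _ (codeLength N + 1) fun e _ => ?_).trans ?_
    · exact Finset.sup_le fun d hd => length_message_le P x hG hn hm ht o hd e
    · rw [Finset.card_univ, Fintype.card_fin, smul_eq_mul]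
      exact Nat.mul_le_mul_right _ hm

end SolitudeVerification

end

theorem theorem1 :
    ∃ (A : QuantumAlgorithm) (C k : ℕ),
      (∀ N : ℕ, A.rounds N ≤ C * N) ∧
      ∀ (N n m : ℕ) (G : MultiDigraph n m) (P : PortNumbering G) (x : Fin n → Bool),
        1 ≤ n → n ≤ N → G.StronglyConnected →
          A.probAnswer P N x (hammingIs 1 x) = 1 ∧
          (m ≤ N ^ 2 →
            ∀ o : Fin (A.rounds N) → Fin n → A.Outcome,
              A.state P N x (A.rounds N) o ≠ 0 →
                (A.bitsSent P N x (A.rounds N) o : ℝ) ≤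
                  C * (N : ℝ) ^ 8 * Real.log ((N : ℝ) + 1) ^ k) := by
  -- `105 = 35 + 60 + 10` sums the coefficients of the bit count, a polynomial of degree `6`, so no
  -- logarithm is needed.
  refine ⟨solitudeAlgorithm, 105, 0, fun N => Nat.mul_le_mul_right N (by norm_num), ?_⟩
  intro N n m G P x hn1 hn hG
  refine ⟨SolitudeVerification.solitudeAlgorithm_probAnswer P x hG hn1 hn, fun hm o _ => ?_⟩
  have hbits := SolitudeVerification.bitsSent_le P x hG hn hm (t := 5 * N) le_rfl o
  have hN : 1 ≤ N := hn1.trans hn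
  have hpow : ∀ i ≤ 6, N ^ i ≤ N ^ 8 := fun i hi => Nat.pow_le_pow_right hN (by omega)
  have hbound : 5 * N * (N ^ 2 * (codeLength N + 1)) ≤ 105 * N ^ 8 := by
    have h3 := hpow 3 (by norm_num)
    have h4 := hpow 4 (by norm_num)
    have h6 := hpow 6 (by norm_num)
    calc 5 * N * (N ^ 2 * (codeLength N + 1)) = 35 * N ^ 6 + 60 * N ^ 4 + 10 * N ^ 3 := by
          unfold codeLength
          ring
      _ ≤ 105 * N ^ 8 := by omega
  rw [pow_zero, mul_one]
  exact_mod_cast hbits.trans hbound
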